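/- Let $p,q\ge 0$ be integers, let $m=(m_Y,m_Z)\in\mathbb R^{p+q}$, and let $$C=\begin{pmatrix} C_Y & C_{YZ}\\ C_{YZ}^\top & C_Z\end{pmatrix}\in\mathbb R^{(p+q)\times(p+q)}$$ be symmetric positive semidefinite with $C_Z\in\mathbb R^{q\times q}$ positive definite. For every $J$ let $(Y_1,Z_1),\dots,(Y_J,Z_J)$ be i.i.d. samples from $\mathcal N(m,C)$ in $\mathbb R^{p+q}$ (the samples for different $J$ may be taken from one sequence or live on different probability spaces). Define the empirical moments $$\tilde m_Y^{(J)}=\frac1J\sum_{i=1}^J Y_i,\qquad \tilde m_Z^{(J)}=\frac1J\sum_{i=1}^J Z_i,$$ $$\tilde C_Y^{(J)}=\frac1{J-1}\sum_{i=1}^J (Y_i-\tilde m_Y^{(J)})(Y_i-\tilde m_Y^{(J)})^\top,\qquad \tilde C_Z^{(J)}=\frac1{J-1}\sum_{i=1}^J (Z_i-\tilde m_Z^{(J)})(Z_i-\tilde m_Z^{(J)})^\top,$$ $$\tilde C_{YZ}^{(J)}=\frac1{J-1}\sum_{i=1}^J (Y_i-\tilde m_Y^{(J)})(Z_i-\tilde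 m_Z^{(J)})^\top .$$ For $z\in\mathbb R^q$ define the exact and empirical conditional means and covariances $$m_{Y|Z=z}=m_Y+C_{YZ}C_Z^{-1}(z-m_Z),\qquad C_{Y|Z=z}=C_Y-C_{YZ}C_Z^{-1}C_{YZ}^\top,$$ $$\tilde m^{(J)}_{Y|Z=z}=\tilde m_Y^{(J)}+\tilde C_{YZ}^{(J)}\bigl(\tilde C_Z^{(J)}\bigr)^\dagger(z-\tilde m_Z^{(J)}),\qquad \tilde C^{(J)}_{Y|Z=z}=\tilde C_Y^{(J)}-\tilde C_{YZ}^{(J)}\bigl(\tilde C_Z^{(J)}\bigr)^\dagger\bigl(\tilde C_{YZ}^{(J)}\bigr)^\top,$$ where $\dagger$ is the Moore--Penrose pseudoinverse. Then, for every fixed $z\in\mathbb R^q$, each of the four random variables $D_J\in[0,\infty]$ $$D_{\mathrm{KL}}\bigl(\mathcal N(\tilde m_Z^{(J)},\tilde C_Z^{(J)})\,\|\,\mathcal N(m_Z,C_Z)\bigr),\qquad D_{\mathrm{KL}}\bigl(\mathcal N(m_Z,C_Z)\,\|\,\mathcal N(\tilde m_Z^{(J)},\tilde C_Z^{(J)})\bigr),$$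 $$D_{\mathrm{KL}}\bigl(\mathcal N(\tilde m^{(J)}_{Y|Z=z},\tilde C^{(J)}_{Y|Z=z})\,\|\,\mathcal N(m_{Y|Z=z},C_{Y|Z=z})\bigr),\qquad D_{\mathrm{KL}}\bigl(\mathcal N(m_{Y|Z=z},C_{Y|Z=z})\,\|\,\mathcal N(\tilde m^{(J)}_{Y|Z=z},\tilde C^{(J)}_{Y|Z=z})\bigr)$$ converges to $0$ in $L^2$ at rate $\mathcal O(J^{-1})$ as $J\to\infty$: for all sufficiently large $J$ it is almost everywhere measurable with $\mathbb E[D_J^2]<\infty$, one has $(\mathbb E[D_J^2])^{1/2}\to0$, and $(\mathbb E[D_J^2])^{1/2}=\mathcal O(J^{-1})$. -/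

import Mathlib

open MeasureTheory ProbabilityTheory InformationTheory Filter Topology Asymptotics
open scoped ENNReal Matrix

noncomputable section

/-- `B` satisfies the four Penrose equations for the real matrix `A`. -/
structure IsMoorePenroseInverse {ι κ : Type*} [Fintype ι] [Fintype κ]
    (A : Matrix ι κ ℝ) (B : Matrix κ ι ℝ) : Prop where
  mul_mul_self : A * B * A = A
  self_mul_mul : B * A * B = B
  transpose_left : (A * B)ᵀ = A * B
  transpose_right : (B * A)ᵀ = B * A

theorem IsMoorePenroseInverse.unique {ι κ : Type*} [Fintype ι] [Fintype κ]
    {A : Matrix ι κ ℝ} {B B' : Matrix κ ι ℝ}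
    (h : IsMoorePenroseInverse A B) (h' : IsMoorePenroseInverse A B') : B = B' := by
  have h1 : A * B = A * B' := by
    calc A * B = (A * B)ᵀ := h.transpose_left.symm
      _ = (A * B' * A * B)ᵀ := by rw [h'.mul_mul_self]
      _ = (A * B)ᵀ * (A * B')ᵀ := by rw [← Matrix.transpose_mul]; simp only [Matrix.mul_assoc]
      _ = A * B * A * B' := by
        rw [h.transpose_left, h'.transpose_left]; simp only [Matrix.mul_assoc]
      _ = A * B' := by rw [h.mul_mul_self]
  have h2 : B * A = B' * A := by
    calc B * A = (B * A)ᵀ := h.transpose_right.symm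
      _ = (B * (A * B' * A))ᵀ := by rw [h'.mul_mul_self]
      _ = (B' * A)ᵀ * (B * A)ᵀ := by rw [← Matrix.transpose_mul]; simp only [Matrix.mul_assoc]
      _ = B' * (A * B * A) := by
        rw [h.transpose_right, h'.transpose_right]; simp only [Matrix.mul_assoc]
      _ = B' * A := by rw [h.mul_mul_self]
  calc B = B * A * B := h.self_mul_mul.symm
    _ = B' * A * B' := by rw [h2, Matrix.mul_assoc, h1, ← Matrix.mul_assoc]
    _ = B' := h'.self_mul_mul

theorem exists_commuting_pinv_of_isSelfAdjoint {κ : Type*} [Fintype κ] [DecidableEq κ]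
    (S : Matrix κ κ ℝ) (hS : IsSelfAdjoint S) :
    ∃ T : Matrix κ κ ℝ, S * T * S = S ∧ T * S * T = T ∧ Tᵀ = T ∧ T * S = S * T := by
  have hc : ∀ f : ℝ → ℝ, ContinuousOn f (spectrum ℝ S) := fun f =>
    (Matrix.finite_real_spectrum (A := S)).continuousOn f
  have hid : cfc (fun x : ℝ => x) S = S := cfc_id' ℝ S
  have hmul : ∀ f g : ℝ → ℝ, cfc f S * cfc g S = cfc (fun x => f x * g x) S :=
    fun f g => (cfc_mul f g _ (hc f) (hc g)).symm
  have h1 : S * cfc (fun x : ℝ => x⁻¹) S = cfc (fun x : ℝ => x * x⁻¹) S := by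
    rw [← hmul, hid]
  have h2 : cfc (fun x : ℝ => x⁻¹) S * S = cfc (fun x : ℝ => x * x⁻¹) S := by
    have := hmul (fun x : ℝ => x⁻¹) (fun x => x)
    rw [hid] at this
    rw [this]
    congr 1
    ext x
    ring
  refine ⟨cfc (fun x : ℝ => x⁻¹) S, ?_, ?_, ?_, h2.trans h1.symm⟩
  · have := hmul (fun x : ℝ => x * x⁻¹) (fun x => x)
    rw [hid] at this
    rw [h1, this]
    simp only [mul_inv_mul_cancel, hid]
  · rw [h2, hmul]
    congr 1
    ext x
    by_cases hx : x = 0 <;> simp [hx]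
  · have := cfc_predicate (fun x : ℝ => x⁻¹) S
    rw [← Matrix.conjTranspose_eq_transpose_of_trivial]
    exact this

theorem exists_isMoorePenroseInverse {ι κ : Type*} [Fintype ι] [Fintype κ]
    (A : Matrix ι κ ℝ) : ∃ B : Matrix κ ι ℝ, IsMoorePenroseInverse A B := by
  classical
  have hS : IsSelfAdjoint (Aᵀ * A) := by
    rw [IsSelfAdjoint, Matrix.star_eq_conjTranspose, Matrix.conjTranspose_eq_transpose_of_trivial]
    simp
  obtain ⟨T, hT1, hT2, hT3, hT4⟩ := exists_commuting_pinv_of_isSelfAdjoint _ hS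
  have hA : A * T * Aᵀ * A = A := by
    have h0 : (A * T * Aᵀ * A - A)ᵀ * (A * T * Aᵀ * A - A) = 0 := by
      have e1 : A * T * Aᵀ * A = A * (T * (Aᵀ * A)) := by simp only [Matrix.mul_assoc]
      have e2 : Aᵀ * (A * (T * (Aᵀ * A)) - A) = 0 := by
        rw [Matrix.mul_sub, sub_eq_zero]
        calc Aᵀ * (A * (T * (Aᵀ * A))) = (Aᵀ * A) * T * (Aᵀ * A) := by
              simp only [Matrix.mul_assoc]
          _ = Aᵀ * A := hT1
      have e3 : (A * (T * (Aᵀ * A)) - A)ᵀ = (T * (Aᵀ * A) - 1)ᵀ * Aᵀ := by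
        rw [← Matrix.transpose_mul, Matrix.mul_sub, Matrix.mul_one]
      rw [e1, e3, Matrix.mul_assoc, e2, Matrix.mul_zero]
    rw [← Matrix.conjTranspose_eq_transpose_of_trivial,
      Matrix.conjTranspose_mul_self_eq_zero] at h0
    exact sub_eq_zero.mp h0
  refine ⟨T * Aᵀ, ?_, ?_, ?_, ?_⟩
  · rw [← Matrix.mul_assoc, hA]
  · calc T * Aᵀ * A * (T * Aᵀ) = T * (Aᵀ * A) * T * Aᵀ := by simp only [Matrix.mul_assoc]
      _ = T * Aᵀ := by rw [hT2]
  · simp only [Matrix.transpose_mul, Matrix.transpose_transpose, hT3, Matrix.mul_assoc]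
  · have : T * Aᵀ * A = T * (Aᵀ * A) := Matrix.mul_assoc _ _ _
    rw [this, Matrix.transpose_mul, Matrix.transpose_mul, Matrix.transpose_transpose, hT3, hT4]

/-- The Moore–Penrose pseudoinverse of a real matrix. -/
def pinv {ι κ : Type*} [Fintype ι] [Fintype κ] (A : Matrix ι κ ℝ) : Matrix κ ι ℝ :=
  Classical.choose (exists_isMoorePenroseInverse A)

theorem isMoorePenroseInverse_pinv {ι κ : Type*} [Fintype ι] [Fintype κ] (A : Matrix ι κ ℝ) :
    IsMoorePenroseInverse A (pinv A) :=
  Classical.choose_spec (exists_isMoorePenroseInverse A)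

/-- The sample mean `(1/J) ∑ xᵢ`. -/
def sampleMean {J d : ℕ} (x : Fin J → EuclideanSpace ℝ (Fin d)) : EuclideanSpace ℝ (Fin d) :=
  (J : ℝ)⁻¹ • ∑ i, x i

/-- The sample cross-covariance `(1/(J-1)) ∑ (xᵢ - x̄)(yᵢ - ȳ)ᵀ`. -/
def sampleCrossCov {J d e : ℕ} (x : Fin J → EuclideanSpace ℝ (Fin d))
    (y : Fin J → EuclideanSpace ℝ (Fin e)) : Matrix (Fin d) (Fin e) ℝ :=
  ((J : ℝ) - 1)⁻¹ •
    ∑ i, Matrix.vecMulVec (x i - sampleMean x).ofLp (y i - sampleMean y).ofLp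

/-- The sample covariance `(1/(J-1)) ∑ (xᵢ - x̄)(xᵢ - x̄)ᵀ`. -/
def sampleCov {J d : ℕ} (x : Fin J → EuclideanSpace ℝ (Fin d)) : Matrix (Fin d) (Fin d) ℝ :=
  sampleCrossCov x x

/-- The vector `(y, z)` of `ℝ^{p+q}` with blocks `y` and `z`. -/
def joinVec {p q : ℕ} (y : EuclideanSpace ℝ (Fin p)) (z : EuclideanSpace ℝ (Fin q)) :
    EuclideanSpace ℝ (Fin p ⊕ Fin q) :=
  WithLp.toLp 2 (Sum.elim y.ofLp z.ofLp)

/-- The conditional mean `m_Y + C_YZ C_Z⁻¹ (z - m_Z)`. -/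
def condMean {p q : ℕ} (mY : EuclideanSpace ℝ (Fin p)) (mZ : EuclideanSpace ℝ (Fin q))
    (CYZ : Matrix (Fin p) (Fin q) ℝ) (CZ : Matrix (Fin q) (Fin q) ℝ)
    (z : EuclideanSpace ℝ (Fin q)) : EuclideanSpace ℝ (Fin p) :=
  mY + WithLp.toLp 2 ((CYZ * CZ⁻¹) *ᵥ (z - mZ).ofLp)

/-- The conditional covariance `C_Y - C_YZ C_Z⁻¹ C_YZᵀ`. -/
def condCov {p q : ℕ} (CY : Matrix (Fin p) (Fin p) ℝ) (CYZ : Matrix (Fin p) (Fin q) ℝ)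
    (CZ : Matrix (Fin q) (Fin q) ℝ) : Matrix (Fin p) (Fin p) ℝ :=
  CY - CYZ * CZ⁻¹ * CYZᵀ

/-- The empirical conditional mean `m̃_Y + C̃_YZ (C̃_Z)† (z - m̃_Z)`. -/
def sampleCondMean {J p q : ℕ} (y : Fin J → EuclideanSpace ℝ (Fin p))
    (w : Fin J → EuclideanSpace ℝ (Fin q)) (z : EuclideanSpace ℝ (Fin q)) :
    EuclideanSpace ℝ (Fin p) :=
  sampleMean y +
    WithLp.toLp 2 ((sampleCrossCov y w * pinv (sampleCov w)) *ᵥ (z - sampleMean w).ofLp)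

/-- The empirical conditional covariance `C̃_Y - C̃_YZ (C̃_Z)† C̃_YZᵀ`. -/
def sampleCondCov {J p q : ℕ} (y : Fin J → EuclideanSpace ℝ (Fin p))
    (w : Fin J → EuclideanSpace ℝ (Fin q)) : Matrix (Fin p) (Fin p) ℝ :=
  sampleCov y - sampleCrossCov y w * pinv (sampleCov w) * (sampleCrossCov y w)ᵀ

/-- `D J → 0` in `L²` at rate `O(r J)`: for all large `J` the random variable `D J` (possibly
infinite-valued) is measurable with finite `L²` norm, and the `L²` norm
`(∫ (D J)² dP_J)^{1/2}` tends to zero and is `O(r J)`. -/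
structure TendstoZeroInL2WithRate {Ω : ℕ → Type*} [∀ J, MeasurableSpace (Ω J)]
    (P : ∀ J, Measure (Ω J)) (D : ∀ J, Ω J → ℝ≥0∞) (r : ℕ → ℝ) : Prop where
  eventually_memLp : ∀ᶠ J in atTop, MemLp (D J) 2 (P J)
  tendsto_zero : Tendsto (fun J => eLpNorm (D J) 2 (P J)) atTop (𝓝 0)
  rate : (fun J => (eLpNorm (D J) 2 (P J)).toReal) =O[atTop] r

end

/-! Standardize the samples. Factor `CZ = L Lᵀ` and the exact conditional covariance as `A Aᵀ`,
where `A` has a left inverse but may have fewer columns than rows, since this covariance may be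
singular. With `K = CYZ CZ⁻¹`, almost surely `Y = mY + A η + K L ζ` and `Z = mZ + L ζ` for standard
Gaussian `(η, ζ)`. For large `J` the empirical covariance of `ζ` is almost surely nonsingular, so
the pseudoinverse is an inverse, and both empirical laws are images of some `N(m, C)` under the same
injective affine map that sends `N(0, 1)` to the exact law. For `Z`, `m` and `C` are the empirical
moments of `ζ`. For `Y` given `Z`, `C` is the Schur complement of the empirical covariance of `(η,
ζ)`. Divergence is invariant under such maps (`klDiv_map_of_leftInverse`), so only divergences to
and from `N(0, 1)` remain.

These are explicit: `(|m|² + tr C - d - log det C) / 2` and `(mᵀ C⁻¹ m + tr C⁻¹ - d + log det C) /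
2`. Each is nonnegative, so each is at most their sum, in which the logarithms cancel: `(|m|² + mᵀ
C⁻¹ m + tr ((C - 1) C⁻¹ (C - 1))) / 2`. This is quadratic in the errors `m` and `C - 1`, apart from
the factor `C⁻¹`. The rate `J⁻¹` follows by Hölder once the errors are `O(J^{-1/2})` in every `Lᵏ`
and `(det C)⁻¹` is bounded in every `Lᵏ`.

The first bound comes from moment generating functions (`lpRate_empirical_mean`). For the second,
`(det C)^{-1/2}` is proportional to `∫ exp (-vᵀ C v) dv`. A weighted Hölder inequality and Tonelli
reduce its moments to the Laplace transform of `vᵀ C v`. Pairing the observations into independent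
differences shows that this transform decays faster than any prescribed power of `1 + |v|²` once `J`
is large (`exists_lintegral_gaussIntegral_pow_le`). The same finiteness gives almost sure
nonsingularity. -/

open scoped NNReal

/-! ### Affine images of Gaussian measures and invariance of the divergence -/

section GaussianAffine

variable {ι κ : Type*} [Fintype ι] [Fintype κ]

theorem measurable_add_mulVec (A : Matrix κ ι ℝ) (b : EuclideanSpace ℝ κ) :
    Measurable fun x : EuclideanSpace ℝ ι => b + WithLp.toLp 2 (A *ᵥ x.ofLp) := by
  have : Measurable fun x : EuclideanSpace ℝ ι => A *ᵥ x.ofLp := by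
    refine measurable_pi_lambda _ fun i => ?_
    simp only [Matrix.mulVec, dotProduct]
    fun_prop
  fun_prop

variable [DecidableEq ι] [DecidableEq κ]

theorem map_add_mulVec_multivariateGaussian (A : Matrix κ ι ℝ) (b : EuclideanSpace ℝ κ)
    (μ : EuclideanSpace ℝ ι) {S : Matrix ι ι ℝ} (hS : S.PosSemidef) :
    (multivariateGaussian μ S).map (fun x => b + WithLp.toLp 2 (A *ᵥ x.ofLp)) =
      multivariateGaussian (b + WithLp.toLp 2 (A *ᵥ μ.ofLp)) (A * S * Aᵀ) := by
  have hm := measurable_add_mulVec A b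
  have hS' : (A * S * Aᵀ).PosSemidef := by
    have := hS.mul_mul_conjTranspose_same A
    rwa [Matrix.conjTranspose_eq_transpose_of_trivial] at this
  have := Measure.isProbabilityMeasure_map hm.aemeasurable (μ := multivariateGaussian μ S)
  refine Measure.ext_of_charFun ?_
  ext t
  have hin : ∀ x : EuclideanSpace ℝ ι, inner ℝ (b + WithLp.toLp 2 (A *ᵥ x.ofLp)) t =
      inner ℝ b t + inner ℝ x (WithLp.toLp 2 (Aᵀ *ᵥ t.ofLp)) := fun x => by
    rw [inner_add_left, EuclideanSpace.inner_eq_star_dotProduct,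
      EuclideanSpace.inner_eq_star_dotProduct, EuclideanSpace.inner_eq_star_dotProduct]
    simp only [star_trivial]
    rw [Matrix.dotProduct_mulVec, ← Matrix.mulVec_transpose, dotProduct_comm (Aᵀ *ᵥ _)]
  rw [charFun_multivariateGaussian hS', charFun_apply, integral_map hm.aemeasurable (by fun_prop)]
  simp only [hin]
  have h1 : ∀ x : EuclideanSpace ℝ ι,
      Complex.exp (((inner ℝ b t + inner ℝ x (WithLp.toLp 2 (Aᵀ *ᵥ t.ofLp)) : ℝ) : ℂ) * Complex.I) =
      Complex.exp ((inner ℝ b t : ℝ) * Complex.I) *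
        Complex.exp ((inner ℝ x (WithLp.toLp 2 (Aᵀ *ᵥ t.ofLp)) : ℝ) * Complex.I) := fun x => by
    rw [← Complex.exp_add]; push_cast; ring_nf
  simp only [h1]
  rw [integral_const_mul, ← charFun_apply, charFun_multivariateGaussian hS, ← Complex.exp_add]
  congr 1
  have h2 : t.ofLp ⬝ᵥ (A * S * Aᵀ) *ᵥ t.ofLp = (Aᵀ *ᵥ t.ofLp) ⬝ᵥ S *ᵥ (Aᵀ *ᵥ t.ofLp) := by
    rw [← Matrix.mulVec_mulVec, ← Matrix.mulVec_mulVec, Matrix.dotProduct_mulVec,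
      ← Matrix.mulVec_transpose]
  rw [h2, real_inner_comm _ t, hin, real_inner_comm μ]
  push_cast
  ring

theorem map_add_mulVec_stdGaussian (A : Matrix κ ι ℝ) (b : EuclideanSpace ℝ κ) :
    (stdGaussian (EuclideanSpace ℝ ι)).map (fun x => b + WithLp.toLp 2 (A *ᵥ x.ofLp)) =
      multivariateGaussian b (A * Aᵀ) := by
  rw [← multivariateGaussian_zero_one, map_add_mulVec_multivariateGaussian _ _ _ .one]
  simp

end GaussianAffine

/-- The data processing inequality applied to `f`, and then to `g`, which undoes it. -/
theorem klDiv_map_of_leftInverse {α β : Type*} [MeasurableSpace α] [MeasurableSpace β]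
    (μ ν : Measure α) [IsFiniteMeasure μ] [IsFiniteMeasure ν] {f : α → β} {g : β → α}
    (hf : Measurable f) (hg : Measurable g) (hgf : Function.LeftInverse g f) :
    klDiv (μ.map f) (ν.map f) = klDiv μ ν := by
  refine le_antisymm (klDiv_map_le μ ν hf) ?_
  have h := klDiv_map_le (μ.map f) (ν.map f) hg
  rwa [Measure.map_map hg hf, Measure.map_map hg hf, hgf.comp_eq_id, Measure.map_id,
    Measure.map_id] at h

/-! ### The Lebesgue density of the standard Gaussian measure -/

section Density

variable {ι : Type*} [Fintype ι]

theorem lintegral_comp_add_mulVec [DecidableEq ι] (A : Matrix ι ι ℝ) (hA : A.det ≠ 0) (b : EuclideanSpace ℝ ι)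
    {g : EuclideanSpace ℝ ι → ℝ≥0∞} (hg : Measurable g) :
    ∫⁻ x : EuclideanSpace ℝ ι, g (b + WithLp.toLp 2 (A *ᵥ x.ofLp)) =
      ENNReal.ofReal |A.det|⁻¹ * ∫⁻ x, g x := by
  have h0 : LinearMap.det (Matrix.toLpLin 2 2 A) = A.det := by
    rw [Matrix.toLpLin_eq_toLin, LinearMap.det_toLin]
  have h1 := Measure.map_linearMap_addHaar_eq_smul_addHaar
    (volume : Measure (EuclideanSpace ℝ ι)) (f := Matrix.toLpLin 2 2 A) (by rwa [h0])
  have hm : Measurable (Matrix.toLpLin 2 2 A) :=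
    (LinearMap.continuous_of_finiteDimensional _).measurable
  calc ∫⁻ x : EuclideanSpace ℝ ι, g (b + WithLp.toLp 2 (A *ᵥ x.ofLp))
      = ∫⁻ y, g (b + y) ∂(volume.map (Matrix.toLpLin 2 2 A)) := by
        rw [lintegral_map (by fun_prop) hm]
        rfl
    _ = ENNReal.ofReal |A.det|⁻¹ * ∫⁻ x, g x := by
        rw [h1, lintegral_smul_measure, lintegral_add_left_eq_self, h0, abs_inv, smul_eq_mul]

/-- Both sides are finite measures with characteristic function `exp (-‖t‖² / 2)`. -/
theorem stdGaussian_eq_withDensity :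
    stdGaussian (EuclideanSpace ℝ ι) = volume.withDensity fun x =>
      ENNReal.ofReal (((2 * Real.pi) ^ (Fintype.card ι / 2 : ℝ))⁻¹ * Real.exp (-‖x‖ ^ 2 / 2)) := by
  set c : ℝ := ((2 * Real.pi) ^ (Fintype.card ι / 2 : ℝ))⁻¹ with hc
  have hmeas : Measurable fun x : EuclideanSpace ℝ ι =>
      ENNReal.ofReal (c * Real.exp (-‖x‖ ^ 2 / 2)) := by fun_prop
  have hint : Integrable fun x : EuclideanSpace ℝ ι => c * Real.exp (-‖x‖ ^ 2 / 2) := by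
    refine Integrable.const_mul ?_ _
    have := GaussianFourier.integrable_cexp_neg_mul_sq_norm_add (V := EuclideanSpace ℝ ι)
      (b := (1 / 2 : ℂ)) (by norm_num) 0 0
    refine (this.norm).congr (ae_of_all _ fun x => ?_)
    simp only [zero_mul, add_zero, Complex.norm_exp]
    congr 1
    have : (-(1 / 2 : ℂ) * (‖x‖ : ℂ) ^ 2) = ((-‖x‖ ^ 2 / 2 : ℝ) : ℂ) := by push_cast; ring
    rw [this, Complex.ofReal_re]
  have hfin : IsFiniteMeasure ((volume : Measure (EuclideanSpace ℝ ι)).withDensity fun x =>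
      ENNReal.ofReal (c * Real.exp (-‖x‖ ^ 2 / 2))) :=
    isFiniteMeasure_withDensity_ofReal hint.2
  refine Measure.ext_of_charFun ?_
  ext t
  rw [charFun_stdGaussian, charFun_apply, integral_withDensity_eq_integral_toReal_smul hmeas
    (ae_of_all _ fun _ => ENNReal.ofReal_lt_top)]
  have h1 : ∀ x : EuclideanSpace ℝ ι, (ENNReal.ofReal (c * Real.exp (-‖x‖ ^ 2 / 2))).toReal •
      Complex.exp ((inner ℝ x t : ℝ) * Complex.I) =
      (c : ℂ) * Complex.exp (-(1 / 2 : ℂ) * ‖x‖ ^ 2 + Complex.I * (inner ℝ t x : ℝ)) := fun x => by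
    rw [ENNReal.toReal_ofReal (by positivity), Complex.exp_add, Complex.real_smul,
      real_inner_comm]
    push_cast
    ring_nf
  simp only [h1]
  rw [integral_const_mul,
    GaussianFourier.integral_cexp_neg_mul_sq_norm_add_of_euclideanSpace (by norm_num)]
  have h2 : ((Real.pi : ℂ) / (1 / 2)) ^ (Fintype.card ι / 2 : ℂ) =
      (((2 * Real.pi) ^ (Fintype.card ι / 2 : ℝ) : ℝ) : ℂ) := by
    rw [Complex.ofReal_cpow (by positivity)]
    push_cast
    congr 1
    ring
  have h3 : (2 * Real.pi) ^ (Fintype.card ι / 2 : ℝ) ≠ 0 := by positivity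
  rw [h2, ← mul_assoc, ← Complex.ofReal_mul, hc, inv_mul_cancel₀ h3]
  simp
  ring_nf

end Density

/-! ### Explicit divergences between Gaussian measures -/

section KullbackLeibler

variable {ι : Type*} [Fintype ι] [DecidableEq ι]

theorem integrable_norm_sq_multivariateGaussian (m : EuclideanSpace ℝ ι) (S : Matrix ι ι ℝ) :
    Integrable (fun x => ‖x‖ ^ 2) (multivariateGaussian m S) :=
  (IsGaussian.memLp_two_id (μ := multivariateGaussian m S)).integrable_norm_pow (by norm_num)

theorem memLp_two_eval_multivariateGaussian (m : EuclideanSpace ℝ ι) (S : Matrix ι ι ℝ) (i : ι) :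
    MemLp (fun x : EuclideanSpace ℝ ι => x i) 2 (multivariateGaussian m S) :=
  (IsGaussian.memLp_two_id (μ := multivariateGaussian m S)).mono (by fun_prop)
    (ae_of_all _ fun x => PiLp.norm_apply_le x i)

theorem integral_eval_multivariateGaussian (m : EuclideanSpace ℝ ι) (S : Matrix ι ι ℝ) (i : ι) :
    ∫ x, x i ∂multivariateGaussian m S = m i := by
  have := (EuclideanSpace.proj (𝕜 := ℝ) i).integral_comp_id_comm
    (IsGaussian.integrable_id (μ := multivariateGaussian m S))
  simpa using this

theorem integral_norm_sq_multivariateGaussian (m : EuclideanSpace ℝ ι) {S : Matrix ι ι ℝ}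
    (hS : S.PosSemidef) : ∫ x, ‖x‖ ^ 2 ∂multivariateGaussian m S = ‖m‖ ^ 2 + S.trace := by
  simp only [EuclideanSpace.real_norm_sq_eq]
  rw [integral_finsetSum _ fun i _ => (memLp_two_eval_multivariateGaussian m S i).integrable_sq,
    Matrix.trace, ← Finset.sum_add_distrib]
  refine Finset.sum_congr rfl fun i _ => ?_
  have h := variance_eval_multivariateGaussian (μ := m) hS i
  rw [variance_eq_sub (memLp_two_eval_multivariateGaussian m S i),
    integral_eval_multivariateGaussian] at h
  simp only [Matrix.diag_apply, ← h, Pi.pow_apply]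
  ring

/-- The logarithm of the density of the image of the standard Gaussian measure under
`x ↦ m + T x` with respect to the standard Gaussian measure. -/
noncomputable def gaussianLogDensity (m : EuclideanSpace ℝ ι) (T : Matrix ι ι ℝ)
    (x : EuclideanSpace ℝ ι) : ℝ :=
  ‖x‖ ^ 2 / 2 - ‖WithLp.toLp 2 (T⁻¹ *ᵥ (x - m).ofLp)‖ ^ 2 / 2 - Real.log |T.det|

theorem measurable_toLp_mulVec {ι κ : Type*} [Fintype ι] [Fintype κ] (A : Matrix κ ι ℝ) :
    Measurable fun x : EuclideanSpace ℝ ι => WithLp.toLp 2 (A *ᵥ x.ofLp) := by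
  simpa using measurable_add_mulVec A 0

theorem measurable_gaussianLogDensity (m : EuclideanSpace ℝ ι) (T : Matrix ι ι ℝ) :
    Measurable (gaussianLogDensity m T) := by
  have := (measurable_toLp_mulVec T⁻¹).comp (measurable_sub_const m)
  unfold gaussianLogDensity
  exact (((measurable_norm.pow_const 2).div_const 2).sub
    ((this.norm.pow_const 2).div_const 2)).sub_const _

theorem toLp_inv_mulVec_add_sub {T : Matrix ι ι ℝ} (hT : T.det ≠ 0) (m x : EuclideanSpace ℝ ι) :
    WithLp.toLp 2 (T⁻¹ *ᵥ ((m + WithLp.toLp 2 (T *ᵥ x.ofLp)) - m).ofLp) = x := by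
  rw [add_sub_cancel_left]
  simp [Matrix.mulVec_mulVec, Matrix.nonsing_inv_mul _ (isUnit_iff_ne_zero.mpr hT)]

theorem map_stdGaussian_eq_withDensity (m : EuclideanSpace ℝ ι) {T : Matrix ι ι ℝ}
    (hT : T.det ≠ 0) :
    (stdGaussian (EuclideanSpace ℝ ι)).map (fun x => m + WithLp.toLp 2 (T *ᵥ x.ofLp)) =
      (stdGaussian (EuclideanSpace ℝ ι)).withDensity
        fun x => ENNReal.ofReal (Real.exp (gaussianLogDensity m T x)) := by
  set c : ℝ := ((2 * Real.pi) ^ (Fintype.card ι / 2 : ℝ))⁻¹ with hc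
  have hm := measurable_add_mulVec T m
  have hd : Measurable fun x => ENNReal.ofReal (Real.exp (gaussianLogDensity m T x)) :=
    (measurable_gaussianLogDensity m T).exp.ennreal_ofReal
  have hφ : Measurable fun x : EuclideanSpace ℝ ι =>
      ENNReal.ofReal (c * Real.exp (-‖x‖ ^ 2 / 2)) := by fun_prop
  ext s hs
  rw [Measure.map_apply hm hs, withDensity_apply _ hs, ← lintegral_indicator hs,
    stdGaussian_eq_withDensity, ← hc, lintegral_withDensity_eq_lintegral_mul _ hφ
      (hd.indicator hs), withDensity_apply _ (hm hs), ← lintegral_indicator (hm hs)]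
  have hG : Measurable ((fun x : EuclideanSpace ℝ ι =>
      ENNReal.ofReal (c * Real.exp (-‖x‖ ^ 2 / 2))) * s.indicator
      fun x => ENNReal.ofReal (Real.exp (gaussianLogDensity m T x))) := hφ.mul (hd.indicator hs)
  have hGm := hG.comp hm
  rw [Function.comp_def] at hGm
  have key := lintegral_comp_add_mulVec T hT m hG
  have hdet : 0 < |T.det| := abs_pos.mpr hT
  have h1 := congrArg (ENNReal.ofReal |T.det| * ·) key
  simp only [← mul_assoc, ← ENNReal.ofReal_mul hdet.le, mul_inv_cancel₀ hdet.ne',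
    ENNReal.ofReal_one, one_mul] at h1
  rw [← h1, ← lintegral_const_mul _ hGm]
  refine lintegral_congr fun x => ?_
  by_cases hx : m + WithLp.toLp 2 (T *ᵥ x.ofLp) ∈ s
  · have hx' : x ∈ (fun x => m + WithLp.toLp 2 (T *ᵥ x.ofLp)) ⁻¹' s := hx
    simp only [Set.indicator_of_mem hx', Pi.mul_apply, Set.indicator_of_mem hx]
    rw [← ENNReal.ofReal_mul (by positivity), ← ENNReal.ofReal_mul (by positivity),
      gaussianLogDensity, toLp_inv_mulVec_add_sub hT, Real.exp_sub, Real.exp_sub,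
      Real.exp_log hdet, neg_div, Real.exp_neg, neg_div, Real.exp_neg]
    congr 1
    field_simp
  · have hx' : x ∉ (fun x => m + WithLp.toLp 2 (T *ᵥ x.ofLp)) ⁻¹' s := hx
    simp [Set.indicator_of_notMem hx', Set.indicator_of_notMem hx]

/-- The log-likelihood ratio is quadratic, so its mean needs only two second moments: that of `x`,
which is `‖m‖² + tr (T Tᵀ)`, and that of `T⁻¹ (x - m)`, which is standard Gaussian and contributes
the dimension. -/
theorem klDiv_map_stdGaussian (m : EuclideanSpace ℝ ι) {T : Matrix ι ι ℝ} (hT : T.det ≠ 0) :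
    klDiv ((stdGaussian (EuclideanSpace ℝ ι)).map fun x => m + WithLp.toLp 2 (T *ᵥ x.ofLp))
      (stdGaussian (EuclideanSpace ℝ ι)) =
    ENNReal.ofReal ((‖m‖ ^ 2 + (T * Tᵀ).trace - Fintype.card ι) / 2 - Real.log |T.det|) := by
  set γ := stdGaussian (EuclideanSpace ℝ ι) with hγ
  set ρ := γ.map fun x => m + WithLp.toLp 2 (T *ᵥ x.ofLp) with hρ
  have hm := measurable_add_mulVec T m
  have hprob : IsProbabilityMeasure ρ := Measure.isProbabilityMeasure_map hm.aemeasurable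
  have hdens := map_stdGaussian_eq_withDensity m hT
  rw [← hγ, ← hρ] at hdens
  have hd : Measurable fun x => ENNReal.ofReal (Real.exp (gaussianLogDensity m T x)) :=
    (measurable_gaussianLogDensity m T).exp.ennreal_ofReal
  have hac : ρ ≪ γ := hdens ▸ withDensity_absolutelyContinuous _ _
  have hllr : llr ρ γ =ᵐ[ρ] gaussianLogDensity m T := by
    refine hac.ae_le ?_
    have := Measure.rnDeriv_withDensity γ hd
    rw [← hdens] at this
    filter_upwards [this] with x hx
    rw [llr, hx, ENNReal.toReal_ofReal (Real.exp_pos _).le, Real.log_exp]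
  have hcov : ρ = multivariateGaussian m (T * Tᵀ) := map_add_mulVec_stdGaussian T m
  have hpsd : (T * Tᵀ).PosSemidef := by
    have := Matrix.posSemidef_self_mul_conjTranspose T
    rwa [Matrix.conjTranspose_eq_transpose_of_trivial] at this
  have hi1 : Integrable (fun x => ‖x‖ ^ 2) ρ :=
    hcov ▸ integrable_norm_sq_multivariateGaussian m _
  have hi0 : Integrable (fun x => ‖x‖ ^ 2) γ := by
    rw [hγ, ← multivariateGaussian_zero_one]
    exact integrable_norm_sq_multivariateGaussian 0 _
  have hcomp : (fun x : EuclideanSpace ℝ ι => ‖WithLp.toLp 2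
      (T⁻¹ *ᵥ ((m + WithLp.toLp 2 (T *ᵥ x.ofLp)) - m).ofLp)‖ ^ 2) = fun x => ‖x‖ ^ 2 := by
    ext x
    rw [toLp_inv_mulVec_add_sub hT]
  have hmeas2 : Measurable fun x : EuclideanSpace ℝ ι =>
      ‖WithLp.toLp 2 (T⁻¹ *ᵥ (x - m).ofLp)‖ ^ 2 :=
    ((measurable_toLp_mulVec T⁻¹).comp (measurable_sub_const m)).norm.pow_const 2
  have hi2 : Integrable (fun x : EuclideanSpace ℝ ι =>
      ‖WithLp.toLp 2 (T⁻¹ *ᵥ (x - m).ofLp)‖ ^ 2) ρ := by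
    rw [hρ, integrable_map_measure hmeas2.aestronglyMeasurable hm.aemeasurable]
    exact hi0.congr (ae_of_all _ fun x => (congrFun hcomp x).symm)
  have hi3 : Integrable (fun x : EuclideanSpace ℝ ι =>
      ‖x‖ ^ 2 / 2 - ‖WithLp.toLp 2 (T⁻¹ *ᵥ (x - m).ofLp)‖ ^ 2 / 2) ρ :=
    (hi1.div_const 2).sub (hi2.div_const 2)
  have hint : Integrable (gaussianLogDensity m T) ρ := hi3.sub (integrable_const _)
  have hγ2 : ∫ x, ‖x‖ ^ 2 ∂γ = Fintype.card ι := by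
    rw [hγ, ← multivariateGaussian_zero_one, integral_norm_sq_multivariateGaussian 0 .one]
    simp
  rw [klDiv_of_ac_of_integrable hac ((integrable_congr hllr).mpr hint), integral_congr_ae hllr]
  congr 1
  simp only [gaussianLogDensity, probReal_univ, add_sub_cancel_right]
  rw [integral_sub hi3 (integrable_const _),
    integral_sub (hi1.div_const 2) (hi2.div_const 2), integral_div, integral_div,
    integral_const, probReal_univ]
  have e2 : ∫ x, ‖WithLp.toLp 2 (T⁻¹ *ᵥ (x - m).ofLp)‖ ^ 2 ∂ρ = Fintype.card ι := by
    rw [hρ, integral_map hm.aemeasurable hmeas2.aestronglyMeasurable, ← hγ2]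
    exact congrArg (fun f => ∫ x, f x ∂γ) hcomp
  rw [e2, hcov, integral_norm_sq_multivariateGaussian m hpsd]
  simp only [one_smul]
  ring

/-- Applying the inverse affine map to both arguments moves the standard Gaussian measure to the
second slot, and the previous formula applies with `T⁻¹` and `-T⁻¹ m`. -/
theorem klDiv_stdGaussian_map (m : EuclideanSpace ℝ ι) {T : Matrix ι ι ℝ} (hT : T.det ≠ 0) :
    klDiv (stdGaussian (EuclideanSpace ℝ ι))
      ((stdGaussian (EuclideanSpace ℝ ι)).map fun x => m + WithLp.toLp 2 (T *ᵥ x.ofLp)) =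
    ENNReal.ofReal ((‖WithLp.toLp 2 (T⁻¹ *ᵥ m.ofLp)‖ ^ 2 + (T⁻¹ * T⁻¹ᵀ).trace -
      Fintype.card ι) / 2 + Real.log |T.det|) := by
  have hu : IsUnit T.det := isUnit_iff_ne_zero.mpr hT
  have hT' : T⁻¹.det ≠ 0 := by
    rw [Matrix.det_nonsing_inv, Ring.inverse_eq_inv']
    exact inv_ne_zero hT
  set m' : EuclideanSpace ℝ ι := -WithLp.toLp 2 (T⁻¹ *ᵥ m.ofLp) with hm'
  have hf := measurable_add_mulVec T m
  have hg := measurable_add_mulVec T⁻¹ m'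
  have hgf : Function.LeftInverse (fun x => m' + WithLp.toLp 2 (T⁻¹ *ᵥ x.ofLp))
      (fun x : EuclideanSpace ℝ ι => m + WithLp.toLp 2 (T *ᵥ x.ofLp)) := fun x => by
    have := toLp_inv_mulVec_add_sub hT m x
    rw [WithLp.ofLp_sub, Matrix.mulVec_sub, WithLp.toLp_sub] at this
    rw [hm']
    simpa [sub_eq_neg_add] using this
  have hfg : Function.RightInverse (fun x => m' + WithLp.toLp 2 (T⁻¹ *ᵥ x.ofLp))
      (fun x : EuclideanSpace ℝ ι => m + WithLp.toLp 2 (T *ᵥ x.ofLp)) := fun x => by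
    simp [hm', Matrix.mulVec_add, Matrix.mulVec_neg, Matrix.mulVec_mulVec,
      Matrix.mul_nonsing_inv _ hu]
  have h := klDiv_map_of_leftInverse
    ((stdGaussian (EuclideanSpace ℝ ι)).map fun x => m' + WithLp.toLp 2 (T⁻¹ *ᵥ x.ofLp))
    (stdGaussian (EuclideanSpace ℝ ι)) hf hg hgf
  rw [Measure.map_map hf hg, hfg.comp_eq_id, Measure.map_id, klDiv_map_stdGaussian m' hT'] at h
  rw [h, hm', norm_neg, Matrix.det_nonsing_inv, Ring.inverse_eq_inv', abs_inv, Real.log_inv,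
    sub_neg_eq_add]

variable {κ : Type*} [Fintype κ] [DecidableEq κ]

open scoped MatrixOrder in
theorem exists_mul_transpose_eq_of_posDef {C : Matrix ι ι ℝ} (hC : C.PosDef) :
    ∃ T : Matrix ι ι ℝ, T.det ≠ 0 ∧ T * Tᵀ = C := by
  obtain ⟨B, hB⟩ := CStarAlgebra.nonneg_iff_eq_star_mul_self.mp hC.posSemidef.nonneg
  rw [Matrix.star_eq_conjTranspose, Matrix.conjTranspose_eq_transpose_of_trivial] at hB
  refine ⟨Bᵀ, fun h => hC.det_pos.ne' ?_, by rw [hB, Matrix.transpose_transpose]⟩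
  rw [hB, Matrix.det_mul, h, zero_mul]

theorem leftInverse_add_mulVec {κ : Type*} [Fintype κ] {A : Matrix κ ι ℝ} {B : Matrix ι κ ℝ}
    (hBA : B * A = 1) (b : EuclideanSpace ℝ κ) : Function.LeftInverse
    (fun x => -WithLp.toLp 2 (B *ᵥ b.ofLp) + WithLp.toLp 2 (B *ᵥ x.ofLp))
    (fun x : EuclideanSpace ℝ ι => b + WithLp.toLp 2 (A *ᵥ x.ofLp)) := fun x => by
  simp [Matrix.mulVec_add, Matrix.mulVec_mulVec, hBA]

/-- `A` need only be injective, so this covers degenerate Gaussians carried by a common affine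
subspace; the divergence is computed in the lower-dimensional coordinates. -/
theorem klDiv_multivariateGaussian_image {A : Matrix κ ι ℝ} {B : Matrix ι κ ℝ} (hBA : B * A = 1)
    (b : EuclideanSpace ℝ κ) (m : EuclideanSpace ℝ ι) {C : Matrix ι ι ℝ} (hC : C.PosDef) :
    klDiv (multivariateGaussian (b + WithLp.toLp 2 (A *ᵥ m.ofLp)) (A * C * Aᵀ))
      (multivariateGaussian b (A * Aᵀ)) =
    ENNReal.ofReal ((‖m‖ ^ 2 + C.trace - Fintype.card ι - Real.log C.det) / 2) := by
  obtain ⟨T, hT, rfl⟩ := exists_mul_transpose_eq_of_posDef hC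
  rw [← map_add_mulVec_multivariateGaussian A b m hC.posSemidef, ← map_add_mulVec_stdGaussian A b,
    klDiv_map_of_leftInverse _ _ (measurable_add_mulVec A b) (measurable_add_mulVec B _)
      (leftInverse_add_mulVec hBA b), ← map_add_mulVec_stdGaussian T m,
    klDiv_map_stdGaussian m hT, Matrix.det_mul, Matrix.det_transpose, ← sq, ← sq_abs T.det,
    Real.log_pow]
  congr 1
  push_cast
  ring

theorem klDiv_multivariateGaussian_image_right {A : Matrix κ ι ℝ} {B : Matrix ι κ ℝ} (hBA : B * A = 1)
    (b : EuclideanSpace ℝ κ) (m : EuclideanSpace ℝ ι) {C : Matrix ι ι ℝ} (hC : C.PosDef) :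
    klDiv (multivariateGaussian b (A * Aᵀ))
      (multivariateGaussian (b + WithLp.toLp 2 (A *ᵥ m.ofLp)) (A * C * Aᵀ)) =
    ENNReal.ofReal ((m.ofLp ⬝ᵥ C⁻¹ *ᵥ m.ofLp + C⁻¹.trace - Fintype.card ι +
      Real.log C.det) / 2) := by
  obtain ⟨T, hT, rfl⟩ := exists_mul_transpose_eq_of_posDef hC
  rw [← map_add_mulVec_multivariateGaussian A b m hC.posSemidef, ← map_add_mulVec_stdGaussian A b,
    klDiv_map_of_leftInverse _ _ (measurable_add_mulVec A b) (measurable_add_mulVec B _)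
      (leftInverse_add_mulVec hBA b), ← map_add_mulVec_stdGaussian T m,
    klDiv_stdGaussian_map m hT, Matrix.det_mul, Matrix.det_transpose, ← sq, ← sq_abs T.det,
    Real.log_pow, Matrix.mul_inv_rev, Matrix.trace_mul_comm Tᵀ⁻¹, Matrix.transpose_nonsing_inv,
    EuclideanSpace.real_norm_sq_eq]
  have : ∑ i, (WithLp.toLp 2 (T⁻¹ *ᵥ m.ofLp) : EuclideanSpace ℝ ι) i ^ 2 =
      m.ofLp ⬝ᵥ (Tᵀ⁻¹ * T⁻¹) *ᵥ m.ofLp := by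
    rw [← Matrix.mulVec_mulVec, Matrix.dotProduct_mulVec, ← Matrix.transpose_nonsing_inv,
      ← Matrix.mulVec_transpose, Matrix.transpose_transpose]
    simp [dotProduct, sq]
  rw [this]
  congr 1
  push_cast
  ring

end KullbackLeibler

/-- All `Lᵏ` norms of the random variables `f J` are `O(r J)` as `J → ∞`. -/
def LpRate {Ω : ℕ → Type*} [∀ J, MeasurableSpace (Ω J)] (P : ∀ J, Measure (Ω J))
    (f : ∀ J, Ω J → ℝ) (r : ℕ → ℝ≥0) : Prop :=
  ∀ k : ℕ, ∃ K : ℝ≥0, ∀ᶠ J in atTop,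
    AEStronglyMeasurable (f J) (P J) ∧ eLpNorm (f J) k (P J) ≤ K * r J

/-! ### Calculus of rates holding in every `Lᵏ` -/

namespace LpRate

variable {Ω : ℕ → Type*} [∀ J, MeasurableSpace (Ω J)] {P : ∀ J, Measure (Ω J)}
  {f g : ∀ J, Ω J → ℝ} {r s : ℕ → ℝ≥0}

theorem congr_ae (hf : LpRate P f r) (h : ∀ᶠ J in atTop, f J =ᵐ[P J] g J) : LpRate P g r := by
  intro k
  obtain ⟨K, hK⟩ := hf k
  refine ⟨K, ?_⟩
  filter_upwards [hK, h] with J hJ hJ'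
  exact ⟨hJ.1.congr hJ', (eLpNorm_congr_ae hJ').symm ▸ hJ.2⟩

theorem mono_rate (hf : LpRate P f r) (C : ℝ≥0) (h : ∀ᶠ J in atTop, r J ≤ C * s J) :
    LpRate P f s := by
  intro k
  obtain ⟨K, hK⟩ := hf k
  refine ⟨K * C, ?_⟩
  filter_upwards [hK, h] with J hJ hJ'
  refine ⟨hJ.1, hJ.2.trans ?_⟩
  rw [← ENNReal.coe_mul, ← ENNReal.coe_mul, ENNReal.coe_le_coe, mul_assoc]
  gcongr

theorem add (hf : LpRate P f r) (hg : LpRate P g r) :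
    LpRate P (fun J ω => f J ω + g J ω) r := by
  intro k
  -- Minkowski needs exponent at least one; for `k = 0` the seminorm is zero by convention and only
  -- measurability remains.
  rcases Nat.eq_zero_or_pos k with rfl | hk
  · obtain ⟨K, hK⟩ := hf 0
    obtain ⟨K', hK'⟩ := hg 0
    refine ⟨0, ?_⟩
    filter_upwards [hK, hK'] with J h h'
    exact ⟨h.1.add h'.1, by simp⟩
  obtain ⟨K, hK⟩ := hf k
  obtain ⟨K', hK'⟩ := hg k
  refine ⟨K + K', ?_⟩
  filter_upwards [hK, hK'] with J h h'
  refine ⟨h.1.add h'.1, (eLpNorm_add_le h.1 h'.1 (by exact_mod_cast hk)).trans ?_⟩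
  rw [ENNReal.coe_add, add_mul]
  exact add_le_add h.2 h'.2

/-- Cauchy–Schwarz doubles the exponent. The rate is required for all `k` precisely so that the
class is closed under products. -/
theorem mul (hf : LpRate P f r) (hg : LpRate P g s) :
    LpRate P (fun J ω => f J ω * g J ω) (fun J => r J * s J) := by
  intro k
  obtain ⟨K, hK⟩ := hf (2 * k)
  obtain ⟨K', hK'⟩ := hg (2 * k)
  refine ⟨K * K', ?_⟩
  have hol : ENNReal.HolderTriple ((2 * k : ℕ) : ℝ≥0∞) ((2 * k : ℕ) : ℝ≥0∞) (k : ℝ≥0∞) := by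
    constructor
    push_cast
    rw [ENNReal.mul_inv (by simp) (by simp), ← add_mul, ENNReal.inv_two_add_inv_two, one_mul]
  filter_upwards [hK, hK'] with J h h'
  refine ⟨h.1.mul h'.1, ?_⟩
  have := eLpNorm_smul_le_mul_eLpNorm (p := ((2 * k : ℕ) : ℝ≥0∞)) (q := ((2 * k : ℕ) : ℝ≥0∞))
    (r := (k : ℝ≥0∞)) h'.1 h.1
  refine (this.trans (mul_le_mul' h.2 h'.2)).trans (le_of_eq ?_)
  push_cast
  ring

theorem bdd_mul (hf : LpRate P f 1) (hg : LpRate P g s) :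
    LpRate P (fun J ω => f J ω * g J ω) s := by
  have h := hf.mul hg
  have : (fun J => (1 : ℕ → ℝ≥0) J * s J) = s := funext fun J => one_mul _
  rwa [this] at h

theorem const [∀ J, IsProbabilityMeasure (P J)] (c : ℝ) : LpRate P (fun _ _ => c) 1 := by
  intro k
  refine ⟨‖c‖₊, Eventually.of_forall fun J => ⟨aestronglyMeasurable_const, ?_⟩⟩
  rcases Nat.eq_zero_or_pos k with rfl | hk
  · simp
  rw [eLpNorm_const _ (by exact_mod_cast hk.ne') (IsProbabilityMeasure.ne_zero _)]
  simp [enorm]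

theorem const_mul [∀ J, IsProbabilityMeasure (P J)] (hf : LpRate P f r) (c : ℝ) :
    LpRate P (fun J ω => c * f J ω) r := by
  exact (const c).bdd_mul hf

theorem neg [∀ J, IsProbabilityMeasure (P J)] (hf : LpRate P f r) :
    LpRate P (fun J ω => -f J ω) r := by
  simpa using hf.const_mul (-1)

theorem sub [∀ J, IsProbabilityMeasure (P J)] (hf : LpRate P f r) (hg : LpRate P g r) :
    LpRate P (fun J ω => f J ω - g J ω) r := by
  simpa [sub_eq_add_neg] using hf.add hg.neg

theorem zero : LpRate P (fun _ _ => 0) r := fun k =>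
  ⟨0, Eventually.of_forall fun J => ⟨aestronglyMeasurable_const, by simp⟩⟩

theorem sum {α : Type*} (t : Finset α) {F : α → ∀ J, Ω J → ℝ} (h : ∀ a ∈ t, LpRate P (F a) r) :
    LpRate P (fun J ω => ∑ a ∈ t, F a J ω) r := by
  classical
  induction t using Finset.induction_on with
  | empty => simpa using zero
  | insert a t ha ih =>
    simp only [Finset.sum_insert ha]
    exact (h a (Finset.mem_insert_self a t)).add
      (ih fun b hb => h b (Finset.mem_insert_of_mem hb))

theorem prod [∀ J, IsProbabilityMeasure (P J)] {α : Type*} (t : Finset α)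
    {F : α → ∀ J, Ω J → ℝ} (h : ∀ a ∈ t, LpRate P (F a) 1) :
    LpRate P (fun J ω => ∏ a ∈ t, F a J ω) 1 := by
  classical
  induction t using Finset.induction_on with
  | empty => simpa using const 1
  | insert a t ha ih =>
    simp only [Finset.prod_insert ha]
    exact (h a (Finset.mem_insert_self a t)).bdd_mul
      (ih fun b hb => h b (Finset.mem_insert_of_mem hb))

section Matrix

variable {ι κ l : Type*} [Fintype ι]

theorem det [∀ J, IsProbabilityMeasure (P J)] [DecidableEq ι] {M : ∀ J, Ω J → Matrix ι ι ℝ}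
    (h : ∀ a b, LpRate P (fun J ω => M J ω a b) 1) : LpRate P (fun J ω => (M J ω).det) 1 := by
  simp only [Matrix.det_apply']
  exact sum _ fun σ _ => (prod _ fun i _ => h _ _).const_mul _

theorem matrix_mul {M : ∀ J, Ω J → Matrix κ ι ℝ} {N : ∀ J, Ω J → Matrix ι l ℝ}
    (hM : ∀ a b, LpRate P (fun J ω => M J ω a b) r)
    (hN : ∀ a b, LpRate P (fun J ω => N J ω a b) s) (a : κ) (b : l) :
    LpRate P (fun J ω => (M J ω * N J ω) a b) (fun J => r J * s J) := by
  simp only [Matrix.mul_apply]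
  exact sum _ fun i _ => (hM a i).mul (hN i b)

theorem mulVec {M : ∀ J, Ω J → Matrix κ ι ℝ} {v : ∀ J, Ω J → ι → ℝ}
    (hM : ∀ a b, LpRate P (fun J ω => M J ω a b) r)
    (hv : ∀ b, LpRate P (fun J ω => v J ω b) s) (a : κ) :
    LpRate P (fun J ω => (M J ω *ᵥ v J ω) a) (fun J => r J * s J) := by
  simp only [Matrix.mulVec, dotProduct]
  exact sum _ fun i _ => (hM a i).mul (hv i)

/-- By Cramer's rule each entry of the inverse is `det⁻¹` times a polynomial in the entries, so
`det⁻¹` is the only inverse quantity to be controlled. -/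
theorem matrix_inv [∀ J, IsProbabilityMeasure (P J)] [DecidableEq ι] {M : ∀ J, Ω J → Matrix ι ι ℝ}
    (h : ∀ a b, LpRate P (fun J ω => M J ω a b) 1)
    (hdet : LpRate P (fun J ω => (M J ω).det⁻¹) 1) (a b : ι) :
    LpRate P (fun J ω => (M J ω)⁻¹ a b) 1 := by
  have h1 : ∀ J (ω : Ω J), (M J ω)⁻¹ a b =
      (M J ω).det⁻¹ * ((M J ω).updateRow b (Pi.single a 1)).det := fun J ω => by
    rw [Matrix.inv_def, Matrix.smul_apply, Matrix.adjugate_apply, Ring.inverse_eq_inv',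
      smul_eq_mul]
  simp only [h1]
  have h2 : LpRate P (fun J ω => ((M J ω).updateRow b (Pi.single a 1)).det) 1 := by
    refine det fun i j => ?_
    simp only [Matrix.updateRow_apply]
    split_ifs
    · exact const _
    · exact h i j
  exact hdet.bdd_mul h2

end Matrix

end LpRate

/-! ### Moments of centered empirical means -/

section EmpiricalMean

theorem Real.exp_le_one_add_add_sq_mul_exp_abs (y : ℝ) :
    Real.exp y ≤ 1 + y + y ^ 2 * Real.exp |y| := by
  have he : 1 ≤ Real.exp |y| := Real.one_le_exp (abs_nonneg y)
  rcases le_or_gt |y| 1 with h | h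
  · have h1 := Real.norm_exp_sub_one_sub_id_le (x := y) h
    rw [Real.norm_eq_abs, Real.norm_eq_abs, sq_abs] at h1
    nlinarith [le_abs_self (Real.exp y - 1 - y), sq_nonneg y]
  · rcases lt_abs.mp h with h | h
    · rw [abs_of_pos (by linarith)] at he ⊢
      nlinarith [mul_le_mul_of_nonneg_right (one_le_pow₀ h.le : 1 ≤ y ^ 2) (Real.exp_pos y).le]
    · have : Real.exp y ≤ 1 := Real.exp_le_one_iff.mpr (by linarith)
      nlinarith [sq_nonneg y]

/-- The linear Taylor term vanishes because `f` is centered. In the remainder `(t f)² exp |t f|`,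
one half of the exponent `s |f|` absorbs `f²` and the other half absorbs `exp |t f|`, hence the
restriction `|t| ≤ s / 2`. -/
theorem exists_mgf_le_one_add {E : Type*} [MeasurableSpace E] {ν : Measure E}
    [IsProbabilityMeasure ν] {f : E → ℝ} (hf : Measurable f) (h0 : ∫ x, f x ∂ν = 0) {s : ℝ}
    (hs : 0 < s) (hexp : Integrable (fun x => Real.exp (s * |f x|)) ν) :
    ∃ B : ℝ, 0 ≤ B ∧ ∀ t, |t| ≤ s / 2 →
      Integrable (fun x => Real.exp (t * f x)) ν ∧ mgf f ν t ≤ 1 + t ^ 2 * B := by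
  have hfi : Integrable f ν := by
    refine (hexp.const_mul s⁻¹).mono' hf.aestronglyMeasurable (ae_of_all _ fun x => ?_)
    rw [Real.norm_eq_abs, le_inv_mul_iff₀ hs]
    linarith [Real.add_one_le_exp (s * |f x|)]
  refine ⟨∫ x, 2 / (s / 2) ^ 2 * Real.exp (s * |f x|) ∂ν,
    integral_nonneg fun x => by positivity, fun t ht => ?_⟩
  have hint : Integrable (fun x => Real.exp (t * f x)) ν := by
    refine hexp.mono' (by fun_prop) (ae_of_all _ fun x => ?_)
    rw [Real.norm_eq_abs, abs_of_pos (Real.exp_pos _)]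
    refine Real.exp_le_exp.mpr ((le_abs_self _).trans ?_)
    rw [abs_mul]
    exact mul_le_mul_of_nonneg_right (by linarith) (abs_nonneg _)
  refine ⟨hint, ?_⟩
  have hpt : ∀ x, Real.exp (t * f x) ≤
      1 + t * f x + t ^ 2 * (2 / (s / 2) ^ 2 * Real.exp (s * |f x|)) := fun x => by
    refine (Real.exp_le_one_add_add_sq_mul_exp_abs _).trans ?_
    have h1 : Real.exp |t * f x| ≤ Real.exp (s / 2 * |f x|) := by
      refine Real.exp_le_exp.mpr ?_
      rw [abs_mul]
      exact mul_le_mul_of_nonneg_right ht (abs_nonneg _)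
    have h2 : (s / 2 * |f x|) ^ 2 ≤ 2 * Real.exp (s / 2 * |f x|) := by
      have h3 : 0 ≤ s / 2 * |f x| := by positivity
      linarith [Real.quadratic_le_exp_of_nonneg h3]
    have h4 : f x ^ 2 ≤ 2 / (s / 2) ^ 2 * Real.exp (s / 2 * |f x|) := by
      rw [mul_pow, sq_abs] at h2
      rw [div_mul_eq_mul_div, le_div_iff₀ (by positivity)]
      linarith
    have h5 : Real.exp (s * |f x|) = Real.exp (s / 2 * |f x|) * Real.exp (s / 2 * |f x|) := by
      rw [← Real.exp_add]; ring_nf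
    have h6 : (t * f x) ^ 2 * Real.exp |t * f x| ≤
        t ^ 2 * (2 / (s / 2) ^ 2 * Real.exp (s * |f x|)) := by
      rw [h5, mul_pow, mul_assoc, ← mul_assoc (2 / (s / 2) ^ 2)]
      gcongr
    linarith
  have hi2 : Integrable (fun x => 1 + t * f x) ν := (integrable_const _).add (hfi.const_mul t)
  have hi3 : Integrable (fun x => t ^ 2 * (2 / (s / 2) ^ 2 * Real.exp (s * |f x|))) ν :=
    (hexp.const_mul _).const_mul _
  calc mgf f ν t ≤ ∫ x, (1 + t * f x + t ^ 2 * (2 / (s / 2) ^ 2 * Real.exp (s * |f x|))) ∂ν :=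
        integral_mono hint (hi2.add hi3) hpt
    _ = _ := by
      rw [integral_add hi2 hi3, integral_add (integrable_const _) (hfi.const_mul t),
        integral_const_mul, h0, integral_const_mul (t ^ 2)]
      simp

theorem eLpNorm_natCast_le {Ω : Type*} [MeasurableSpace Ω] {P : Measure Ω} {g : Ω → ℝ} {k : ℕ}
    (hk : k ≠ 0) {C : ℝ≥0∞} (h : ∫⁻ ω, ‖g ω‖ₑ ^ k ∂P ≤ C) :
    eLpNorm g k P ≤ C ^ (1 / (k : ℝ)) := by
  rw [eLpNorm_eq_lintegral_rpow_enorm_toReal (by exact_mod_cast hk) (by simp)]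
  simp only [ENNReal.toReal_natCast, ENNReal.rpow_natCast]
  gcongr

variable {Ω : ℕ → Type*} [∀ J, MeasurableSpace (Ω J)] {P : ∀ J, Measure (Ω J)}
  {E : Type*} [MeasurableSpace E] {ν : Measure E}
  [IsProbabilityMeasure ν] {X : ∀ J, Fin J → Ω J → E}

/-- By independence the normalized sum `J^{-1/2} ∑ f (Xᵢ)` has generating function at most `(1 + t²
B / J)^J ≤ exp (t² B)`, uniformly in `J`. Its exponential moments at `± s / 2` then bound all its
polynomial moments. -/
theorem lpRate_empirical_mean (hX : ∀ J i, HasLaw (X J i) ν (P J))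
    (hindep : ∀ J, iIndepFun (X J) (P J)) {f : E → ℝ} (hf : Measurable f)
    (h0 : ∫ x, f x ∂ν = 0) {s : ℝ} (hs : 0 < s)
    (hexp : Integrable (fun x => Real.exp (s * |f x|)) ν) :
    LpRate P (fun J ω => (J : ℝ)⁻¹ * ∑ i, f (X J i ω)) (fun J => (NNReal.sqrt J)⁻¹) := by
  obtain ⟨B, hB, hmgf⟩ := exists_mgf_le_one_add hf h0 hs hexp
  intro k
  have hmeas : ∀ J : ℕ, AEStronglyMeasurable (fun ω => (J : ℝ)⁻¹ * ∑ i, f (X J i ω)) (P J) :=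
    fun J => by
      have : ∀ i, AEMeasurable (fun ω => f (X J i ω)) (P J) := fun i =>
        hf.comp_aemeasurable (hX J i).aemeasurable
      exact ((Finset.aemeasurable_fun_sum _ fun i _ => this i).const_mul _).aestronglyMeasurable
  rcases Nat.eq_zero_or_pos k with rfl | hk
  · exact ⟨0, Eventually.of_forall fun J => ⟨hmeas J, by simp⟩⟩
  set M : ℝ≥0 := (k.factorial * (2 * Real.exp ((s / 2) ^ 2 * B))).toNNReal with hM
  refine ⟨(s / 2).toNNReal⁻¹ * M ^ (1 / (k : ℝ)), ?_⟩
  filter_upwards [eventually_ge_atTop 1] with J hJ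
  refine ⟨hmeas J, ?_⟩
  have hJ0 : (0 : ℝ) < J := by exact_mod_cast hJ
  have hsq : (1 : ℝ) ≤ √J := Real.one_le_sqrt.mpr (by exact_mod_cast hJ)
  have hmgfsum : ∀ t, |t| ≤ s / 2 →
      Integrable (fun ω => Real.exp (t / √J * ∑ i, f (X J i ω))) (P J) ∧
      ∫ ω, Real.exp (t / √J * ∑ i, f (X J i ω)) ∂P J ≤ Real.exp ((s / 2) ^ 2 * B) := by
    intro t ht
    have ht' : |t / √J| ≤ s / 2 := by
      rw [abs_div, abs_of_pos (by linarith : 0 < √J)]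
      exact (div_le_self (abs_nonneg t) hsq).trans ht
    obtain ⟨hi, hle⟩ := hmgf _ ht'
    have hind : iIndepFun (fun i ω => f (X J i ω)) (P J) :=
      (hindep J).comp (fun _ => f) fun _ => hf
    have hlaw : ∀ i, mgf (fun ω => f (X J i ω)) (P J) (t / √J) = mgf f ν (t / √J) := fun i =>
      (hX J i).integral_comp (f := fun x => Real.exp (t / √J * f x))
        (by fun_prop)
    have hsum := hind.mgf_sum₀ (t := t / √J)
      (fun i => hf.comp_aemeasurable (hX J i).aemeasurable) Finset.univ
    have heq : (∑ i, fun ω => f (X J i ω)) = fun ω => ∑ i, f (X J i ω) := by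
      ext ω; simp
    rw [heq] at hsum
    simp only [hlaw, Finset.prod_const, Finset.card_univ, Fintype.card_fin] at hsum
    have hpos : 0 < mgf f ν (t / √J) := mgf_pos hi
    constructor
    -- The generating function of a non-integrable exponential is zero by convention, so positivity
    -- of the product formula proves integrability.
    · refine not_imp_comm.mp mgf_undef ?_
      rw [hsum]
      positivity
    · change mgf _ _ _ ≤ _
      rw [hsum]
      have hsq2 : (t / √J) ^ 2 = t ^ 2 / J := by rw [div_pow, Real.sq_sqrt hJ0.le]
      have h3 : t ^ 2 ≤ (s / 2) ^ 2 := sq_le_sq' (by linarith [neg_abs_le t]) ((le_abs_self t).trans ht)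
      calc mgf f ν (t / √J) ^ J ≤ (1 + (t / √J) ^ 2 * B) ^ J := by gcongr
        _ ≤ (Real.exp ((t / √J) ^ 2 * B)) ^ J := by
          gcongr
          linarith [Real.add_one_le_exp ((t / √J) ^ 2 * B)]
        _ = Real.exp (t ^ 2 * B) := by
          rw [← Real.exp_nat_mul, hsq2]
          congr 1
          field_simp
        _ ≤ Real.exp ((s / 2) ^ 2 * B) := by gcongr
  set y : Ω J → ℝ := fun ω => s / 2 / √J * ∑ i, f (X J i ω) with hy
  obtain ⟨hi1, hle1⟩ := hmgfsum (s / 2) (abs_of_pos (by positivity)).le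
  obtain ⟨hi2, hle2⟩ := hmgfsum (-(s / 2)) (by rw [abs_neg]; exact (abs_of_pos (by positivity)).le)
  have hpt : ∀ ω, ‖y ω‖ ^ k ≤ k.factorial * (Real.exp (s / 2 / √J * ∑ i, f (X J i ω)) +
      Real.exp (-(s / 2) / √J * ∑ i, f (X J i ω))) := fun ω => by
    have h1 := Real.pow_div_factorial_le_exp |y ω| (abs_nonneg _) k
    rw [div_le_iff₀ (by positivity)] at h1
    have h2 : Real.exp |y ω| ≤ Real.exp (y ω) + Real.exp (-y ω) := by
      rcases abs_choice (y ω) with h | h <;> rw [h] <;>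
        linarith [Real.exp_pos (y ω), Real.exp_pos (-y ω)]
    have h3 : -(s / 2) / √J * ∑ i, f (X J i ω) = -y ω := by rw [hy]; ring
    rw [h3, Real.norm_eq_abs]
    calc |y ω| ^ k ≤ Real.exp |y ω| * k.factorial := h1
      _ ≤ (Real.exp (y ω) + Real.exp (-y ω)) * k.factorial := by gcongr
      _ = _ := by rw [mul_comm]
  have hlint : ∫⁻ ω, ‖y ω‖ₑ ^ k ∂P J ≤ M := by
    have hle : ∀ ω, ‖y ω‖ₑ ^ k ≤ ENNReal.ofReal (k.factorial *
        (Real.exp (s / 2 / √J * ∑ i, f (X J i ω)) +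
          Real.exp (-(s / 2) / √J * ∑ i, f (X J i ω)))) := fun ω => by
      rw [← ofReal_norm, ← ENNReal.ofReal_pow (norm_nonneg _)]
      exact ENNReal.ofReal_le_ofReal (hpt ω)
    refine (lintegral_mono hle).trans ?_
    have hi3 : Integrable (fun ω => k.factorial *
        (Real.exp (s / 2 / √J * ∑ i, f (X J i ω)) +
          Real.exp (-(s / 2) / √J * ∑ i, f (X J i ω)))) (P J) := (hi1.add hi2).const_mul _
    rw [← ofReal_integral_eq_lintegral_ofReal hi3 (ae_of_all _ fun ω => by positivity),
      integral_const_mul, integral_add hi1 hi2]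
    refine ENNReal.ofReal_le_ofReal ?_
    refine mul_le_mul_of_nonneg_left ?_ (by positivity)
    linarith
  have hscale : (fun ω => (J : ℝ)⁻¹ * ∑ i, f (X J i ω)) = ((s / 2)⁻¹ * (√J)⁻¹) • y := by
    ext ω
    simp only [hy, Pi.smul_apply, smul_eq_mul]
    have h1 : (J : ℝ) = √J * √J := (Real.mul_self_sqrt hJ0.le).symm
    rw [← mul_assoc]
    congr 1
    nth_rewrite 1 [h1]
    field_simp
  rw [hscale, eLpNorm_const_smul]
  have hc : ‖(s / 2)⁻¹ * (√(J : ℝ))⁻¹‖ₑ =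
      (((s / 2).toNNReal⁻¹ * (NNReal.sqrt J)⁻¹ : ℝ≥0) : ℝ≥0∞) := by
    rw [enorm_eq_nnnorm, ENNReal.coe_inj]
    ext
    rw [coe_nnnorm, Real.norm_of_nonneg (by positivity)]
    simp [Real.coe_toNNReal _ (by positivity : 0 ≤ s / 2)]
  rw [hc]
  refine (mul_le_mul_right (eLpNorm_natCast_le hk.ne' hlint) _).trans (le_of_eq ?_)
  rw [← ENNReal.coe_rpow_of_nonneg _ (by positivity)]
  push_cast
  ring

end EmpiricalMean

/-! ### Algebra of empirical covariances -/

section EmpiricalCovariance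

variable {J : ℕ} {κ l : Type*}

/-- The componentwise average of a finite family of vectors. -/
noncomputable def vecMean (x : Fin J → κ → ℝ) (a : κ) : ℝ := (J : ℝ)⁻¹ * ∑ i, x i a

/-- The data matrix of a finite family of vectors, centered at the average. -/
noncomputable def centeredData (x : Fin J → κ → ℝ) : Matrix (Fin J) κ ℝ :=
  Matrix.of fun i a => x i a - vecMean x a

/-- The empirical cross-covariance matrix, for arbitrary coordinate types. -/
noncomputable def empCov (x : Fin J → κ → ℝ) (y : Fin J → l → ℝ) : Matrix κ l ℝ :=
  ((J : ℝ) - 1)⁻¹ • ((centeredData x)ᵀ * centeredData y)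

theorem empCov_apply (x : Fin J → κ → ℝ) (y : Fin J → l → ℝ) (a : κ) (b : l) :
    empCov x y a b =
      ((J : ℝ) - 1)⁻¹ * ∑ i, (x i a - vecMean x a) * (y i b - vecMean y b) := by
  simp [empCov, centeredData, Matrix.mul_apply]

theorem empCov_transpose (x : Fin J → κ → ℝ) (y : Fin J → l → ℝ) :
    (empCov x y)ᵀ = empCov y x := by
  simp [empCov, Matrix.transpose_smul, Matrix.transpose_mul]

theorem posSemidef_empCov [Finite κ] (x : Fin J → κ → ℝ) (hJ : 1 ≤ J) :
    (empCov x x).PosSemidef := by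
  have h := Matrix.posSemidef_conjTranspose_mul_self (centeredData x)
  rw [Matrix.conjTranspose_eq_transpose_of_trivial] at h
  refine h.smul (inv_nonneg.mpr ?_)
  have : (1 : ℝ) ≤ J := by exact_mod_cast hJ
  linarith

theorem sum_centered_mul (hJ : 0 < J) (x y : Fin J → ℝ) :
    ∑ i, (x i - (J : ℝ)⁻¹ * ∑ j, x j) * (y i - (J : ℝ)⁻¹ * ∑ j, y j) =
      ∑ i, x i * y i - J * (((J : ℝ)⁻¹ * ∑ j, x j) * ((J : ℝ)⁻¹ * ∑ j, y j)) := by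
  have h : (J : ℝ) ≠ 0 := by exact_mod_cast hJ.ne'
  simp only [sub_mul, mul_sub, Finset.sum_sub_distrib, ← Finset.sum_mul, ← Finset.mul_sum,
    Finset.sum_const, Finset.card_univ, Fintype.card_fin, nsmul_eq_mul]
  field_simp
  ring

theorem empCov_apply_eq (hJ : 0 < J) (x : Fin J → κ → ℝ) (y : Fin J → l → ℝ) (a : κ) (b : l) :
    empCov x y a b =
      ((J : ℝ) - 1)⁻¹ * (∑ i, x i a * y i b - J * (vecMean x a * vecMean y b)) := by
  rw [empCov_apply]
  congr 1
  exact sum_centered_mul hJ (fun i => x i a) fun i => y i b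

theorem dotProduct_empCov_mulVec [Fintype κ] (x : Fin J → κ → ℝ) (v : κ → ℝ) :
    v ⬝ᵥ empCov x x *ᵥ v = ((J : ℝ) - 1)⁻¹ *
      ∑ i, (v ⬝ᵥ x i - (J : ℝ)⁻¹ * ∑ j, v ⬝ᵥ x j) ^ 2 := by
  rw [empCov, Matrix.smul_mulVec, dotProduct_smul, smul_eq_mul, ← Matrix.mulVec_mulVec,
    Matrix.dotProduct_mulVec, Matrix.vecMul_transpose]
  congr 1
  rw [dotProduct]
  refine Finset.sum_congr rfl fun i _ => ?_
  have : (centeredData x *ᵥ v) i = v ⬝ᵥ x i - (J : ℝ)⁻¹ * ∑ j, v ⬝ᵥ x j := by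
    simp only [Matrix.mulVec, dotProduct, centeredData, Matrix.of_apply, vecMean, sub_mul,
      Finset.sum_sub_distrib]
    congr 1
    · exact Finset.sum_congr rfl fun a _ => mul_comm _ _
    · rw [Finset.sum_comm (γ := Fin J), Finset.mul_sum]
      refine Finset.sum_congr rfl fun a _ => ?_
      rw [mul_assoc, Finset.sum_mul]
      congr 1
      exact Finset.sum_congr rfl fun i _ => mul_comm _ _
  rw [this, sq]

theorem vecMean_affine [Fintype κ] (hJ : 0 < J) (M : Matrix l κ ℝ) (b : l → ℝ)
    (x : Fin J → κ → ℝ) :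
    vecMean (fun i => b + M *ᵥ x i) = b + M *ᵥ vecMean x := by
  have h : (J : ℝ) ≠ 0 := by exact_mod_cast hJ.ne'
  ext c
  simp only [vecMean, Pi.add_apply, Matrix.mulVec, dotProduct, Finset.sum_add_distrib,
    Finset.sum_const, Finset.card_univ, Fintype.card_fin, nsmul_eq_mul, mul_add,
    inv_mul_cancel_left₀ h]
  congr 1
  rw [Finset.sum_comm, Finset.mul_sum]
  refine Finset.sum_congr rfl fun a _ => ?_
  rw [← Finset.mul_sum]
  ring

theorem centeredData_affine [Fintype κ] (hJ : 0 < J) (M : Matrix l κ ℝ) (b : l → ℝ)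
    (x : Fin J → κ → ℝ) :
    centeredData (fun i => b + M *ᵥ x i) = centeredData x * Mᵀ := by
  ext i c
  simp only [centeredData, Matrix.of_apply, vecMean_affine hJ, Pi.add_apply, Matrix.mul_apply,
    Matrix.transpose_apply, add_sub_add_left_eq_sub, Matrix.mulVec, dotProduct, sub_mul,
    Finset.sum_sub_distrib]
  congr 1 <;> exact Finset.sum_congr rfl fun a _ => mul_comm _ _

theorem empCov_affine {l' κ' : Type*} [Fintype κ] [Fintype κ'] (hJ : 0 < J) (M : Matrix l κ ℝ)
    (b : l → ℝ) (x : Fin J → κ → ℝ) (M' : Matrix l' κ' ℝ) (b' : l' → ℝ) (y : Fin J → κ' → ℝ) :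
    empCov (fun i => b + M *ᵥ x i) (fun i => b' + M' *ᵥ y i) = M * empCov x y * M'ᵀ := by
  rw [empCov, empCov, centeredData_affine hJ, centeredData_affine hJ, Matrix.transpose_mul,
    Matrix.transpose_transpose, Matrix.mul_smul, Matrix.smul_mul]
  simp only [Matrix.mul_assoc]

/-- From `(a - b)² / 2 ≤ (a - c)² + (b - c)²`. The center `c`, later the sample mean that couples
all observations, disappears, and differences over disjoint pairs remain; these are independent. -/
theorem sum_sq_centered_ge {n : ℕ} (e : Fin n ⊕ Fin n → Fin J) (he : Function.Injective e)
    (u : Fin J → ℝ) (c : ℝ) :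
    ∑ k : Fin n, (u (e (.inl k)) - u (e (.inr k))) ^ 2 / 2 ≤ ∑ i, (u i - c) ^ 2 := by
  calc ∑ k : Fin n, (u (e (.inl k)) - u (e (.inr k))) ^ 2 / 2
      ≤ ∑ k : Fin n, ((u (e (.inl k)) - c) ^ 2 + (u (e (.inr k)) - c) ^ 2) := by
        refine Finset.sum_le_sum fun k _ => ?_
        nlinarith [sq_nonneg (u (e (.inl k)) - c + (u (e (.inr k)) - c))]
    _ = ∑ s : Fin n ⊕ Fin n, (u (e s) - c) ^ 2 := by
        rw [Fintype.sum_sum_type, Finset.sum_add_distrib]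
    _ = ∑ i ∈ Finset.univ.map ⟨e, he⟩, (u i - c) ^ 2 := by rw [Finset.sum_map]; rfl
    _ ≤ ∑ i, (u i - c) ^ 2 :=
        Finset.sum_le_sum_of_subset_of_nonneg (Finset.subset_univ _) fun _ _ _ => sq_nonneg _

end EmpiricalCovariance

theorem LpRate.const_seq {Ω : ℕ → Type*} [∀ J, MeasurableSpace (Ω J)] {P : ∀ J, Measure (Ω J)}
    [∀ J, IsProbabilityMeasure (P J)] {c : ℕ → ℝ} {r : ℕ → ℝ≥0} (C : ℝ≥0)
    (h : ∀ᶠ J in atTop, |c J| ≤ C * r J) : LpRate P (fun J _ => c J) r := by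
  intro k
  refine ⟨C, ?_⟩
  filter_upwards [h] with J hJ
  refine ⟨aestronglyMeasurable_const, ?_⟩
  rcases Nat.eq_zero_or_pos k with rfl | hk
  · simp
  rw [eLpNorm_const _ (by exact_mod_cast hk.ne') (IsProbabilityMeasure.ne_zero _)]
  simp only [measure_univ, ENNReal.one_rpow, mul_one, enorm_eq_nnnorm]
  rw [← ENNReal.coe_mul, ENNReal.coe_le_coe]
  exact_mod_cast hJ

/-! ### Rates for the empirical moments of standard Gaussian samples -/

section GaussianSample

variable {κ : Type*} [Fintype κ]

/-- Fernique's theorem: some `exp (C ‖x‖²)` is integrable, and the growth of `f` is at most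
quadratic. -/
theorem integrable_exp_abs_of_le_sq {E : Type*} [NormedAddCommGroup E] [NormedSpace ℝ E]
    [MeasurableSpace E] [BorelSpace E] [SecondCountableTopology E] [CompleteSpace E]
    (ν : Measure E) [IsGaussian ν] {f : E → ℝ} (hf : Measurable f)
    (h : ∀ x, |f x| ≤ 1 + ‖x‖ ^ 2) :
    ∃ s, 0 < s ∧ Integrable (fun x => Real.exp (s * |f x|)) ν := by
  obtain ⟨C, hC, hint⟩ := IsGaussian.exists_integrable_exp_sq ν
  refine ⟨C, hC, (hint.const_mul (Real.exp C)).mono'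
    ((hf.norm.const_mul C).exp).aestronglyMeasurable (ae_of_all _ fun x => ?_)⟩
  rw [Real.norm_of_nonneg (Real.exp_pos _).le, ← Real.exp_add]
  refine Real.exp_le_exp.mpr ?_
  nlinarith [h x]

variable {Ω : ℕ → Type*} [∀ J, MeasurableSpace (Ω J)] {P : ∀ J, Measure (Ω J)}
  {X : ∀ J, Fin J → Ω J → EuclideanSpace ℝ κ}

theorem lpRate_vecMean (hX : ∀ J i, HasLaw (X J i) (stdGaussian (EuclideanSpace ℝ κ)) (P J))
    (hindep : ∀ J, iIndepFun (X J) (P J)) (a : κ) :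
    LpRate P (fun J ω => vecMean (fun i => (X J i ω).ofLp) a) (fun J => (NNReal.sqrt J)⁻¹) := by
  classical
  have hle : ∀ x : EuclideanSpace ℝ κ, |x a| ≤ 1 + ‖x‖ ^ 2 := fun x => by
    have := PiLp.norm_apply_le x a
    rw [Real.norm_eq_abs] at this
    nlinarith [sq_nonneg (‖x‖ - 1), norm_nonneg x]
  have hm : Measurable fun x : EuclideanSpace ℝ κ => x a := by fun_prop
  obtain ⟨s, hs, hi⟩ := integrable_exp_abs_of_le_sq (stdGaussian (EuclideanSpace ℝ κ)) hm hle
  have h0 : ∫ x, x a ∂stdGaussian (EuclideanSpace ℝ κ) = 0 := by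
    rw [← multivariateGaussian_zero_one, integral_eval_multivariateGaussian]
    simp
  simpa only [vecMean] using lpRate_empirical_mean hX hindep hm h0 hs hi

/-- With `δ` the entry of the identity, the error equals `J / (J - 1)` times the mean of `xₐ x_b -
δ` minus the product of the two means, plus `δ / (J - 1)`. The first mean is centered, and the
product is even of order `J⁻¹`. -/
theorem lpRate_empCov_sub_one [∀ J, IsProbabilityMeasure (P J)] [DecidableEq κ]
    (hX : ∀ J i, HasLaw (X J i) (stdGaussian (EuclideanSpace ℝ κ)) (P J))
    (hindep : ∀ J, iIndepFun (X J) (P J)) (a b : κ) :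
    LpRate P (fun J ω => empCov (fun i => (X J i ω).ofLp) (fun i => (X J i ω).ofLp) a b -
      (1 : Matrix κ κ ℝ) a b) (fun J => (NNReal.sqrt J)⁻¹) := by
  set δ : ℝ := (1 : Matrix κ κ ℝ) a b with hδ
  have hδ1 : |δ| ≤ 1 := by
    rw [hδ, Matrix.one_apply]
    split_ifs <;> simp
  have hm : Measurable fun x : EuclideanSpace ℝ κ => x a * x b - δ := by fun_prop
  have hle : ∀ x : EuclideanSpace ℝ κ, |x a * x b - δ| ≤ 1 + ‖x‖ ^ 2 := fun x => by
    have h1 := PiLp.norm_apply_le x a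
    have h2 := PiLp.norm_apply_le x b
    calc |x a * x b - δ| ≤ |x a * x b| + |δ| := abs_sub _ _
      _ ≤ ‖x‖ * ‖x‖ + 1 := by
        rw [abs_mul]
        exact add_le_add (mul_le_mul h1 h2 (abs_nonneg _) (norm_nonneg _)) hδ1
      _ = _ := by ring
  obtain ⟨s, hs, hi⟩ := integrable_exp_abs_of_le_sq (stdGaussian (EuclideanSpace ℝ κ)) hm hle
  have h0 : ∫ x, (x a * x b - δ) ∂stdGaussian (EuclideanSpace ℝ κ) = 0 := by
    rw [← multivariateGaussian_zero_one]
    have hc := covariance_eval_multivariateGaussian (μ := (0 : EuclideanSpace ℝ κ))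
      (Matrix.PosSemidef.one (n := κ) (R := ℝ)) a b
    have ha := memLp_two_eval_multivariateGaussian (0 : EuclideanSpace ℝ κ) 1 a
    have hb := memLp_two_eval_multivariateGaussian (0 : EuclideanSpace ℝ κ) 1 b
    rw [covariance_eq_sub ha hb, integral_eval_multivariateGaussian,
      integral_eval_multivariateGaussian] at hc
    have hab : Integrable (fun x : EuclideanSpace ℝ κ => x a * x b)
        (multivariateGaussian (0 : EuclideanSpace ℝ κ) 1) := ha.integrable_mul hb
    rw [integral_sub hab (integrable_const _)]
    simp only [Pi.mul_apply, PiLp.zero_apply, mul_zero, sub_zero] at hc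
    rw [hc, integral_const, probReal_univ, one_smul, hδ, sub_self]
  have hmain := lpRate_empirical_mean hX hindep hm h0 hs hi
  have hmean := (lpRate_vecMean hX hindep a).mul (lpRate_vecMean hX hindep b)
  have hsq : ∀ᶠ J : ℕ in atTop, (1 : ℝ≥0) ≤ NNReal.sqrt J := by
    filter_upwards [eventually_ge_atTop 1] with J hJ
    rw [NNReal.one_le_sqrt]
    exact_mod_cast hJ
  have hmean' : LpRate P (fun J ω => vecMean (fun i => (X J i ω).ofLp) a *
      vecMean (fun i => (X J i ω).ofLp) b) (fun J => (NNReal.sqrt J)⁻¹) := by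
    refine hmean.mono_rate 1 ?_
    filter_upwards [hsq] with J hJ
    gcongr
    exact inv_le_one_of_one_le₀ hJ
  have hc1 : LpRate P (fun J _ => (J : ℝ) / (J - 1)) 1 := by
    refine LpRate.const_seq 2 ?_
    filter_upwards [eventually_ge_atTop 2] with J hJ
    have hJ' : (2 : ℝ) ≤ J := by exact_mod_cast hJ
    rw [abs_of_nonneg (div_nonneg (by linarith) (by linarith)), div_le_iff₀ (by linarith)]
    simp
    linarith
  have hc2 : LpRate P (fun J _ => δ / ((J : ℝ) - 1)) (fun J => (NNReal.sqrt J)⁻¹) := by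
    refine LpRate.const_seq 2 ?_
    filter_upwards [eventually_ge_atTop 2] with J hJ
    have hJ' : (2 : ℝ) ≤ J := by exact_mod_cast hJ
    have h1 : 1 ≤ √(J : ℝ) := Real.one_le_sqrt.mpr (by linarith)
    have h2 : √(J : ℝ) * √J = J := Real.mul_self_sqrt (by linarith)
    rw [abs_div, abs_of_nonneg (by linarith : (0 : ℝ) ≤ J - 1), div_le_iff₀ (by linarith)]
    push_cast
    rw [mul_assoc, inv_mul_eq_div, ← mul_div_assoc, le_div_iff₀ (by linarith)]
    calc |δ| * √J ≤ 1 * √J := by gcongr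
      _ ≤ 2 * ((J : ℝ) - 1) := by nlinarith
  refine ((hc1.bdd_mul (hmain.sub hmean')).add hc2).congr_ae ?_
  filter_upwards [eventually_ge_atTop 2] with J hJ
  refine ae_of_all _ fun ω => ?_
  have hJ' : (2 : ℝ) ≤ J := by exact_mod_cast hJ
  have hJ1 : (J : ℝ) - 1 ≠ 0 := by linarith
  have hJ0 : (J : ℝ) ≠ 0 := by linarith
  simp only [empCov_apply_eq (by omega : 0 < J), Finset.sum_sub_distrib, Finset.sum_const,
    Finset.card_univ, Fintype.card_fin, nsmul_eq_mul]
  field_simp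
  ring

end GaussianSample

/-! ### Laplace transform of the empirical quadratic form -/

section LaplaceTransform

theorem lintegral_pi_prod_comp_eval {ι E : Type*} [Fintype ι] [MeasurableSpace E] (μ : Measure E)
    [IsProbabilityMeasure μ] {h : ι → E → ℝ≥0∞} (hh : ∀ i, Measurable (h i)) :
    ∫⁻ x, ∏ i, h i (x i) ∂Measure.pi (fun _ : ι => μ) = ∏ i, ∫⁻ y, h i y ∂μ := by
  have hind := iIndepFun_pi (μ := fun _ : ι => μ) (X := h) fun i => (hh i).aemeasurable
  rw [lintegral_prod_eq_prod_lintegral_of_indepFun _ _ hind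
    fun i => (hh i).comp (measurable_pi_apply i)]
  refine Finset.prod_congr rfl fun i _ => ?_
  exact (measurePreserving_eval (fun _ : ι => μ) i).lintegral_comp (hh i)

/-- Disjoint pairs of independent variables are independent, so Tonelli factorizes the integral. -/
theorem lintegral_prod_pairs {Ω E : Type*} [MeasurableSpace Ω] [MeasurableSpace E] {Q : Measure Ω}
    {μ : Measure E} [IsProbabilityMeasure μ] {n : ℕ} {X : Fin n ⊕ Fin n → Ω → E}
    (hX : ∀ i, HasLaw (X i) μ Q) (hind : iIndepFun X Q) {g : E → E → ℝ≥0∞}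
    (hg : Measurable (Function.uncurry g)) :
    ∫⁻ ω, ∏ k, g (X (.inl k) ω) (X (.inr k) ω) ∂Q = (∫⁻ x, ∫⁻ y, g x y ∂μ ∂μ) ^ n := by
  have hlaw := hind.hasLaw_pi hX
  have hgm : ∀ k : Fin n, Measurable fun p : (Fin n → E) × (Fin n → E) => g (p.1 k) (p.2 k) :=
    fun k => by
      have h : Measurable fun p : (Fin n → E) × (Fin n → E) => (p.1 k, p.2 k) := by fun_prop
      exact hg.comp h
  have hprod : Measurable fun p : (Fin n → E) × (Fin n → E) => ∏ k, g (p.1 k) (p.2 k) :=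
    Finset.measurable_fun_prod _ fun k _ => hgm k
  have hmp := measurePreserving_sumPiEquivProdPi (fun _ : Fin n ⊕ Fin n => μ)
  have h1 : ∫⁻ ω, ∏ k, g (X (.inl k) ω) (X (.inr k) ω) ∂Q =
      ∫⁻ x, ∏ k, g (x (.inl k)) (x (.inr k)) ∂Measure.pi (fun _ : Fin n ⊕ Fin n => μ) :=
    hlaw.lintegral_comp (f := fun x => ∏ k, g (x (.inl k)) (x (.inr k)))
      (hprod.comp hmp.measurable).aemeasurable
  rw [h1]
  have h2 := hmp.lintegral_comp hprod
  refine Eq.trans h2 ?_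
  rw [lintegral_prod _ hprod.aemeasurable]
  have h3 : ∀ x : Fin n → E, ∫⁻ y, ∏ k, g (x k) (y k) ∂Measure.pi (fun _ : Fin n => μ) =
      ∏ k, ∫⁻ y, g (x k) y ∂μ := fun x =>
    lintegral_pi_prod_comp_eval μ fun k => hg.comp measurable_prodMk_left
  refine (lintegral_congr h3).trans ?_
  rw [lintegral_pi_prod_comp_eval μ (h := fun _ x => ∫⁻ y, g x y ∂μ)
    fun _ => hg.lintegral_prod_right']
  simp

theorem lintegral_exp_neg_mul_sq_gaussianReal (v : ℝ≥0) {t : ℝ} (ht : 0 ≤ t) :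
    ∫⁻ w, ENNReal.ofReal (Real.exp (-(t * w ^ 2))) ∂gaussianReal 0 v =
      ENNReal.ofReal (√(1 + 2 * t * v))⁻¹ := by
  have hint : Integrable (fun w : ℝ => Real.exp (-(t * w ^ 2))) (gaussianReal 0 v) := by
    refine (integrable_const (1 : ℝ)).mono' (by fun_prop) (ae_of_all _ fun w => ?_)
    rw [Real.norm_of_nonneg (Real.exp_pos _).le]
    exact Real.exp_le_one_iff.mpr (by nlinarith [sq_nonneg w])
  rw [← ofReal_integral_eq_lintegral_ofReal hint (ae_of_all _ fun w => (Real.exp_pos _).le)]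
  congr 1
  by_cases hv : v = 0
  · simp [hv]
  have hv' : (0 : ℝ) < v := by positivity
  rw [integral_gaussianReal_eq_integral_smul hv]
  have h1 : ∀ w : ℝ, gaussianPDFReal 0 v w • Real.exp (-(t * w ^ 2)) =
      (√(2 * Real.pi * v))⁻¹ * Real.exp (-(1 / (2 * v) + t) * w ^ 2) := fun w => by
    rw [gaussianPDFReal_def, smul_eq_mul, mul_assoc, ← Real.exp_add]
    congr 2
    field_simp
    ring
  simp only [h1]
  rw [integral_const_mul, integral_gaussian, ← Real.sqrt_inv, ← Real.sqrt_inv,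
    ← Real.sqrt_mul (by positivity)]
  congr 1
  field_simp

theorem lintegral_exp_neg_mul_sub_sq_gaussianReal (v : ℝ≥0) {t : ℝ} (ht : 0 ≤ t) :
    ∫⁻ x, ∫⁻ y, ENNReal.ofReal (Real.exp (-(t * (x - y) ^ 2))) ∂gaussianReal 0 v
      ∂gaussianReal 0 v = ENNReal.ofReal (√(1 + 4 * t * v))⁻¹ := by
  have hm : Measurable fun w : ℝ => ENNReal.ofReal (Real.exp (-(t * w ^ 2))) := by fun_prop
  have h1 := lintegral_exp_neg_mul_sq_gaussianReal (v + v) ht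
  have hc := gaussianReal_conv_gaussianReal (m₁ := 0) (m₂ := 0) (v₁ := v) (v₂ := v)
  rw [zero_add] at hc
  rw [← hc, Measure.lintegral_conv hm] at h1
  have h2 : ∀ x : ℝ, ∫⁻ y, ENNReal.ofReal (Real.exp (-(t * (x - y) ^ 2))) ∂gaussianReal 0 v =
      ∫⁻ y, ENNReal.ofReal (Real.exp (-(t * (x + y) ^ 2))) ∂gaussianReal 0 v := fun x => by
    have hn := gaussianReal_map_neg (μ := 0) (v := v)
    rw [neg_zero] at hn
    conv_rhs => rw [← hn]
    rw [lintegral_map (by fun_prop) measurable_neg]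
    simp [sub_eq_add_neg]
  rw [lintegral_congr h2, h1]
  congr 4
  push_cast
  ring

theorem hasLaw_inner_stdGaussian {κ : Type*} [Fintype κ] (v : EuclideanSpace ℝ κ) :
    HasLaw (fun x : EuclideanSpace ℝ κ => v.ofLp ⬝ᵥ x.ofLp) (gaussianReal 0 (‖v‖₊ ^ 2))
      (stdGaussian (EuclideanSpace ℝ κ)) := by
  have h : (fun x : EuclideanSpace ℝ κ => v.ofLp ⬝ᵥ x.ofLp) = innerSL ℝ v := by
    ext x
    rw [innerSL_apply_apply, EuclideanSpace.inner_eq_star_dotProduct, star_trivial,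
      dotProduct_comm]
  rw [h]
  refine ⟨by fun_prop, ?_⟩
  rw [IsGaussian.map_eq_gaussianReal, integral_strongDual_stdGaussian, variance_dual_stdGaussian,
    innerSL_apply_norm]
  congr 1
  ext
  simp

/-- Group the `n` factors into `M` blocks of length `⌊n / M⌋`, apply Bernoulli to each, and use `n ≤
2 M ⌊n / M⌋`. The lower bound has degree `M` in `a` and does not depend on `n`. -/
theorem one_add_div_pow_ge {a : ℝ} (ha : 0 ≤ a) {M n : ℕ} (hM : 0 < M) (hn : M ≤ n) :
    (1 + a / (2 * M)) ^ M ≤ (1 + a / n) ^ n := by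
  have hn0 : (0 : ℝ) < n := by exact_mod_cast hM.trans_le hn
  have hM0 : (0 : ℝ) < M := by exact_mod_cast hM
  have hl : (n : ℝ) ≤ 2 * M * (n / M : ℕ) := by
    have h1 : n < M * (n / M) + M := by
      have := Nat.div_add_mod n M
      have := Nat.mod_lt n hM
      omega
    have h2 : 1 ≤ n / M := (Nat.one_le_div_iff hM).mpr hn
    have h3 : n ≤ 2 * M * (n / M) := by nlinarith
    exact_mod_cast h3
  have hb := one_add_mul_le_pow (a := a / n) (by have := div_nonneg ha hn0.le; linarith) (n / M)
  calc (1 + a / (2 * M)) ^ M ≤ (1 + (n / M : ℕ) * (a / n)) ^ M := by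
        gcongr
        rw [div_le_iff₀ (by positivity), mul_div_assoc', div_mul_eq_mul_div, le_div_iff₀ hn0]
        nlinarith
    _ ≤ ((1 + a / n) ^ (n / M)) ^ M := by gcongr
    _ = (1 + a / n) ^ (n / M * M) := by rw [pow_mul]
    _ ≤ (1 + a / n) ^ n :=
        pow_le_pow_right₀ (by have := div_nonneg ha hn0.le; linarith) (Nat.div_mul_le_self n M)

variable {κ : Type*} [Fintype κ]

/-- Here `n = ⌊J / 2⌋`; for odd `J` one observation is left unpaired. Each pair contributes the
factor `(1 + 2 k ‖v‖² / (J - 1))^{-1/2}`, and `J - 1 ≤ 2 n` gives the stated bound. -/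
theorem lintegral_exp_neg_mul_empCov_le {J : ℕ} {n : ℕ} (hn : 0 < n) (hJ : 2 * n ≤ J)
    (hJ' : J ≤ 2 * n + 1) (v : EuclideanSpace ℝ κ) {k : ℝ} (hk : 0 ≤ k) :
    ∫⁻ x : Fin J → EuclideanSpace ℝ κ, ENNReal.ofReal (Real.exp (-(k *
      (v.ofLp ⬝ᵥ empCov (fun i => (x i).ofLp) (fun i => (x i).ofLp) *ᵥ v.ofLp))))
      ∂Measure.pi (fun _ : Fin J => stdGaussian (EuclideanSpace ℝ κ)) ≤
    ENNReal.ofReal (√((1 + k * ‖v‖ ^ 2 / n) ^ n))⁻¹ := by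
  set Q := Measure.pi (fun _ : Fin J => stdGaussian (EuclideanSpace ℝ κ)) with hQ
  have hn1 : (1 : ℝ) ≤ n := by exact_mod_cast hn
  have hJr : (2 : ℝ) * n ≤ J := by exact_mod_cast hJ
  have hJr' : (J : ℝ) ≤ 2 * n + 1 := by exact_mod_cast hJ'
  have hJ1 : (0 : ℝ) < J - 1 := by linarith
  let e : Fin n ⊕ Fin n → Fin J := fun s => Fin.castLE (by omega) (finSumFinEquiv s)
  have he : Function.Injective e :=
    (Fin.castLE_injective (by omega : n + n ≤ J)).comp finSumFinEquiv.injective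
  -- The factor `1 / (J - 1)` is the normalization of the covariance, and `1 / 2` comes from
  -- `sum_sq_centered_ge`.
  set t : ℝ := k / (2 * (J - 1)) with ht
  have ht0 : 0 ≤ t := by positivity
  let u : Fin J → (Fin J → EuclideanSpace ℝ κ) → ℝ := fun i x => v.ofLp ⬝ᵥ (x i).ofLp
  have hum : Measurable fun y : EuclideanSpace ℝ κ => v.ofLp ⬝ᵥ y.ofLp := by
    simp only [dotProduct]
    fun_prop
  have hlaw : ∀ i, HasLaw (u i) (gaussianReal 0 (‖v‖₊ ^ 2)) Q := fun i =>
    (hasLaw_inner_stdGaussian v).comp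
      (measurePreserving_eval (fun _ : Fin J => stdGaussian (EuclideanSpace ℝ κ)) i).hasLaw
  have hind : iIndepFun u Q :=
    iIndepFun_pi (μ := fun _ : Fin J => stdGaussian (EuclideanSpace ℝ κ))
      (X := fun _ y => v.ofLp ⬝ᵥ y.ofLp) fun _ => hum.aemeasurable
  have hpt : ∀ x : Fin J → EuclideanSpace ℝ κ, ENNReal.ofReal (Real.exp (-(k *
      (v.ofLp ⬝ᵥ empCov (fun i => (x i).ofLp) (fun i => (x i).ofLp) *ᵥ v.ofLp)))) ≤
      ∏ j : Fin n, ENNReal.ofReal (Real.exp (-(t * (u (e (.inl j)) x - u (e (.inr j)) x) ^ 2))) :=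
    fun x => by
    rw [← ENNReal.ofReal_prod_of_nonneg fun _ _ => (Real.exp_pos _).le, ← Real.exp_sum]
    refine ENNReal.ofReal_le_ofReal (Real.exp_le_exp.mpr ?_)
    rw [Finset.sum_neg_distrib, neg_le_neg_iff, dotProduct_empCov_mulVec, ← mul_assoc]
    have := sum_sq_centered_ge e he (fun i => u i x) ((J : ℝ)⁻¹ * ∑ j, u j x)
    calc ∑ j : Fin n, t * (u (e (.inl j)) x - u (e (.inr j)) x) ^ 2
        = k * (J - 1 : ℝ)⁻¹ * ∑ j : Fin n, (u (e (.inl j)) x - u (e (.inr j)) x) ^ 2 / 2 := by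
          rw [Finset.mul_sum]
          refine Finset.sum_congr rfl fun j _ => ?_
          rw [ht]
          field_simp
      _ ≤ _ := mul_le_mul_of_nonneg_left this (by positivity)
  refine (lintegral_mono hpt).trans ?_
  rw [lintegral_prod_pairs (X := fun s => u (e s)) (fun s => hlaw (e s)) (hind.precomp he)
    (g := fun a b => ENNReal.ofReal (Real.exp (-(t * (a - b) ^ 2))))
    (by unfold Function.uncurry; fun_prop),
    lintegral_exp_neg_mul_sub_sq_gaussianReal _ ht0, ← ENNReal.ofReal_pow (by positivity)]
  refine ENNReal.ofReal_le_ofReal ?_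
  rw [inv_pow]
  refine inv_anti₀ (by positivity) (Real.sqrt_le_iff.mpr ⟨by positivity, ?_⟩)
  rw [← pow_mul, mul_comm n 2, pow_mul, Real.sq_sqrt (by positivity)]
  gcongr
  push_cast
  rw [ht, div_le_iff₀ (by positivity)]
  have h0 : 0 ≤ k * ‖v‖ ^ 2 := by positivity
  have h1 : 4 * (k / (2 * ((J : ℝ) - 1))) * ‖v‖ ^ 2 * n = k * ‖v‖ ^ 2 * (2 * n / (J - 1)) := by
    field_simp
    ring
  rw [h1]
  refine le_mul_of_one_le_right h0 ?_
  rw [le_div_iff₀ hJ1]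
  linarith

theorem lintegral_exp_neg_mul_empCov_le_pow {J N : ℕ} (hN : 0 < N) (hJ : 4 * N ≤ J)
    (v : EuclideanSpace ℝ κ) {k : ℝ} (hk : 1 ≤ k) :
    ∫⁻ x : Fin J → EuclideanSpace ℝ κ, ENNReal.ofReal (Real.exp (-(k *
      (v.ofLp ⬝ᵥ empCov (fun i => (x i).ofLp) (fun i => (x i).ofLp) *ᵥ v.ofLp))))
      ∂Measure.pi (fun _ : Fin J => stdGaussian (EuclideanSpace ℝ κ)) ≤
    ENNReal.ofReal ((4 * N) ^ N * ((1 + ‖v‖ ^ 2) ^ N)⁻¹) := by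
  refine (lintegral_exp_neg_mul_empCov_le (n := J / 2) (by omega) (by omega) (by omega) v
    (by linarith)).trans (ENNReal.ofReal_le_ofReal ?_)
  have hN1 : (1 : ℝ) ≤ N := by exact_mod_cast hN
  -- Degree `2 N` is needed because the square root in the Laplace bound halves it; `4 N ≤ J`
  -- ensures `2 N ≤ J / 2`.
  have h1 := one_add_div_pow_ge (a := k * ‖v‖ ^ 2) (by positivity) (M := 2 * N) (n := J / 2)
    (by omega) (by omega)
  have h2 : (((1 + ‖v‖ ^ 2) / (4 * N)) ^ N) ^ 2 ≤ (1 + k * ‖v‖ ^ 2 / (J / 2 : ℕ)) ^ (J / 2) := by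
    refine le_trans ?_ h1
    rw [← pow_mul, mul_comm N 2]
    gcongr
    rw [div_le_iff₀ (by positivity)]
    push_cast
    have h3 : k * ‖v‖ ^ 2 / (2 * (2 * N)) * (4 * N) = k * ‖v‖ ^ 2 := by field_simp; norm_num
    rw [add_mul, h3]
    nlinarith [sq_nonneg ‖v‖]
  have h3 := Real.le_sqrt_of_sq_le h2
  calc _ ≤ (((1 + ‖v‖ ^ 2) / (4 * N)) ^ N)⁻¹ := inv_anti₀ (by positivity) h3
    _ = _ := by rw [div_pow, inv_div, div_eq_mul_inv]

end LaplaceTransform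

/-! ### Determinants as Gaussian integrals -/

section Determinant

variable {κ : Type*} [Fintype κ]

/-- The Gaussian integral `∫ exp (-xᵀ C x) dx`, as an extended nonnegative number. -/
noncomputable def gaussIntegral (C : Matrix κ κ ℝ) : ℝ≥0∞ :=
  ∫⁻ x : EuclideanSpace ℝ κ, ENNReal.ofReal (Real.exp (-(x.ofLp ⬝ᵥ C *ᵥ x.ofLp)))

theorem measurable_quadForm (C : Matrix κ κ ℝ) :
    Measurable fun x : EuclideanSpace ℝ κ => x.ofLp ⬝ᵥ C *ᵥ x.ofLp := by
  simp only [dotProduct, Matrix.mulVec]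
  fun_prop

variable [DecidableEq κ]

/-- Rescaling by `√2` reduces this to the normalization of the standard Gaussian density. Only
positivity and finiteness of the value matter later. -/
theorem gaussIntegral_one_eq : gaussIntegral (1 : Matrix κ κ ℝ) =
    ENNReal.ofReal ((2 * Real.pi) ^ (Fintype.card κ / 2 : ℝ) * |(√2)⁻¹ ^ Fintype.card κ|) := by
  have h := congrArg (fun μ => μ Set.univ) (stdGaussian_eq_withDensity (ι := κ))
  simp only [measure_univ, withDensity_apply _ MeasurableSet.univ, Measure.restrict_univ] at h
  set c : ℝ := (2 * Real.pi) ^ (Fintype.card κ / 2 : ℝ) with hc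
  have hc0 : 0 < c := by positivity
  have hm : Measurable fun x : EuclideanSpace ℝ κ => ENNReal.ofReal (Real.exp (-‖x‖ ^ 2 / 2)) := by
    fun_prop
  have h1 : ENNReal.ofReal c = ∫⁻ x : EuclideanSpace ℝ κ,
      ENNReal.ofReal (Real.exp (-‖x‖ ^ 2 / 2)) := by
    simp only [ENNReal.ofReal_mul (inv_nonneg.mpr hc0.le)] at h
    rw [lintegral_const_mul _ hm] at h
    calc ENNReal.ofReal c = ENNReal.ofReal c * 1 := (mul_one _).symm
      _ = _ := by
        rw [h, ← mul_assoc, ← ENNReal.ofReal_mul hc0.le, mul_inv_cancel₀ hc0.ne']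
        simp
  have hdet : ((√2 : ℝ) • (1 : Matrix κ κ ℝ)).det = √2 ^ Fintype.card κ := by simp
  have h2 := lintegral_comp_add_mulVec ((√2 : ℝ) • (1 : Matrix κ κ ℝ))
    (by rw [hdet]; positivity) 0 hm
  rw [hdet, ← h1] at h2
  rw [gaussIntegral, mul_comm c, ENNReal.ofReal_mul (abs_nonneg _), inv_pow, abs_inv, ← h2]
  refine lintegral_congr fun x => ?_
  congr 2
  simp only [Matrix.smul_mulVec, Matrix.one_mulVec, zero_add, WithLp.toLp_smul, norm_smul,
    WithLp.toLp_ofLp, mul_pow, Real.norm_eq_abs, sq_abs, EuclideanSpace.real_norm_sq_eq]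
  simp [dotProduct, sq]
  ring

theorem gaussIntegral_posDef {C : Matrix κ κ ℝ} (hC : C.PosDef) :
    gaussIntegral C = ENNReal.ofReal (√C.det)⁻¹ * gaussIntegral (1 : Matrix κ κ ℝ) := by
  obtain ⟨T, hT, rfl⟩ := exists_mul_transpose_eq_of_posDef hC
  have hm : Measurable fun x : EuclideanSpace ℝ κ =>
      ENNReal.ofReal (Real.exp (-(x.ofLp ⬝ᵥ (1 : Matrix κ κ ℝ) *ᵥ x.ofLp))) :=
    (measurable_quadForm 1).neg.exp.ennreal_ofReal
  have h := lintegral_comp_add_mulVec Tᵀ (by rwa [Matrix.det_transpose]) 0 hm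
  rw [Matrix.det_transpose] at h
  rw [Matrix.det_mul, Matrix.det_transpose, ← sq, Real.sqrt_sq_eq_abs]
  refine Eq.trans (lintegral_congr fun x => ?_) h
  congr 3
  rw [← Matrix.mulVec_mulVec, Matrix.dotProduct_mulVec, ← Matrix.mulVec_transpose]
  simp

theorem gaussIntegral_one_pos : gaussIntegral (1 : Matrix κ κ ℝ) ≠ 0 := by
  rw [gaussIntegral_one_eq, ne_eq, ENNReal.ofReal_eq_zero, not_le]
  positivity

theorem gaussIntegral_one_ne_top : gaussIntegral (1 : Matrix κ κ ℝ) ≠ ∞ := by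
  rw [gaussIntegral_one_eq]
  exact ENNReal.ofReal_ne_top

/-- Regularize: `gaussIntegral 1 = gaussIntegral (C + ε) * √det (C + ε) ≤ gaussIntegral C * √det (C
+ ε)`. If `det C = 0` and the integral were finite, the right side would tend to zero as `ε → 0`,
although the left side is positive. -/
theorem det_ne_zero_of_gaussIntegral_ne_top {C : Matrix κ κ ℝ} (hC : C.PosSemidef)
    (h : gaussIntegral C ≠ ∞) : C.det ≠ 0 := by
  intro hdet
  have hbound : ∀ ε : ℝ, 0 < ε → gaussIntegral (1 : Matrix κ κ ℝ) ≤
      gaussIntegral C * ENNReal.ofReal √(C + ε • (1 : Matrix κ κ ℝ)).det := fun ε hε => by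
    have hP : (C + ε • (1 : Matrix κ κ ℝ)).PosDef :=
      Matrix.PosDef.posSemidef_add hC (Matrix.PosDef.one.smul hε)
    have h1 : gaussIntegral (C + ε • (1 : Matrix κ κ ℝ)) ≤ gaussIntegral C := by
      refine lintegral_mono fun x => ENNReal.ofReal_le_ofReal (Real.exp_le_exp.mpr ?_)
      rw [Matrix.add_mulVec, dotProduct_add, Matrix.smul_mulVec, Matrix.one_mulVec,
        dotProduct_smul, smul_eq_mul]
      have : 0 ≤ x.ofLp ⬝ᵥ x.ofLp := by
        simp only [dotProduct]
        exact Finset.sum_nonneg fun i _ => mul_self_nonneg _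
      nlinarith
    rw [gaussIntegral_posDef hP] at h1
    have hs : 0 < √(C + ε • (1 : Matrix κ κ ℝ)).det := Real.sqrt_pos.mpr hP.det_pos
    calc gaussIntegral (1 : Matrix κ κ ℝ)
        = ENNReal.ofReal (√(C + ε • (1 : Matrix κ κ ℝ)).det)⁻¹ *
          gaussIntegral (1 : Matrix κ κ ℝ) *
          ENNReal.ofReal √(C + ε • (1 : Matrix κ κ ℝ)).det := by
          rw [mul_right_comm, ← ENNReal.ofReal_mul (by positivity), inv_mul_cancel₀ hs.ne']
          simp
      _ ≤ _ := by gcongr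
  have hcont : Continuous fun ε : ℝ => √(C + ε • (1 : Matrix κ κ ℝ)).det := by
    refine Real.continuous_sqrt.comp (Continuous.matrix_det ?_)
    fun_prop
  have hlim : Tendsto (fun ε : ℝ => gaussIntegral C *
      ENNReal.ofReal √(C + ε • (1 : Matrix κ κ ℝ)).det) (𝓝[>] 0) (𝓝 0) := by
    have h1 := (ENNReal.continuous_ofReal.comp hcont).tendsto 0
    simp only [Function.comp_apply, zero_smul, add_zero, hdet, Real.sqrt_zero,
      ENNReal.ofReal_zero] at h1
    have h2 := ENNReal.Tendsto.const_mul (a := gaussIntegral C) (h1.mono_left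
      (nhdsWithin_le_nhds (s := Set.Ioi 0))) (Or.inr h)
    rwa [mul_zero] at h2
  have := ge_of_tendsto hlim (eventually_nhdsWithin_of_forall hbound)
  exact gaussIntegral_one_pos (le_antisymm this bot_le)

/-- Equality holds for positive definite `C`; the exponent is `2 k` because the integral scales like
`det^{-1/2}`. For singular `C` the left side is zero, as `0⁻¹ = 0` and `k ≠ 0`. -/
theorem inv_det_pow_le_gaussIntegral {C : Matrix κ κ ℝ} (hC : C.PosSemidef) {k : ℕ} (hk : k ≠ 0) :
    ‖C.det⁻¹‖ₑ ^ k ≤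
      (gaussIntegral (1 : Matrix κ κ ℝ))⁻¹ ^ (2 * k) * gaussIntegral C ^ (2 * k) := by
  by_cases hdet : C.det = 0
  · simp [hdet, hk]
  have hP : C.PosDef := by
    rw [hC.posDef_iff_isUnit]
    exact (Matrix.isUnit_iff_isUnit_det _).mpr (isUnit_iff_ne_zero.mpr hdet)
  have hs : 0 < C.det := hP.det_pos
  rw [gaussIntegral_posDef hP, ← mul_pow, mul_left_comm,
    ENNReal.inv_mul_cancel gaussIntegral_one_pos gaussIntegral_one_ne_top, mul_one, pow_mul,
    ← ENNReal.ofReal_pow (by positivity), inv_pow, Real.sq_sqrt hs.le,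
    Real.enorm_eq_ofReal (by positivity)]

end Determinant

/-! ### Inverse moments of the empirical determinant -/

section InverseMoments

variable {κ : Type*} [Fintype κ]

/-- Hölder for `f = (f / w) * w` with exponent `k` and its conjugate `q`: `w ≤ 1` gives `w ^ q ≤ w`,
and `k / q = k - 1`. The power moves inside the integral, where an expectation can be taken by
Tonelli. -/
theorem lintegral_pow_le_mul_lintegral {α : Type*} [MeasurableSpace α] (μ : Measure α)
    {f w : α → ℝ≥0∞} (hf : AEMeasurable f μ) (hw : AEMeasurable w μ) (hw1 : ∀ x, w x ≤ 1)
    (hw0 : ∀ x, w x ≠ 0) {k : ℕ} (hk : 2 ≤ k) :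
    (∫⁻ x, f x ∂μ) ^ k ≤
      (∫⁻ x, w x ∂μ) ^ (k - 1) * ∫⁻ x, f x ^ k * ((w x)⁻¹) ^ k ∂μ := by
  have hk1 : (1 : ℝ) < k := by exact_mod_cast hk
  have hk0 : (0 : ℝ) < k := by linarith
  have hconj := Real.HolderConjugate.conjExponent hk1
  set q := Real.conjExponent (k : ℝ) with hq
  have h1 : ∀ x, f x = (f x * (w x)⁻¹) * w x := fun x => by
    rw [mul_assoc, ENNReal.inv_mul_cancel (hw0 x) (ne_top_of_le_ne_top ENNReal.one_ne_top (hw1 x)),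
      mul_one]
  have h2 := ENNReal.lintegral_mul_le_Lp_mul_Lq μ hconj (hf.mul hw.inv) hw
  have h3 : ∫⁻ x, f x ∂μ = ∫⁻ x, ((fun x => f x * (w x)⁻¹) * w) x ∂μ := lintegral_congr h1
  have hqp : 0 < q := hconj.symm.pos
  have h4 : ∫⁻ x, w x ^ q ∂μ ≤ ∫⁻ x, w x ∂μ := by
    refine lintegral_mono fun x => ?_
    calc w x ^ q ≤ w x ^ (1 : ℝ) :=
          ENNReal.rpow_le_rpow_of_exponent_ge (hw1 x) hconj.symm.lt.le
      _ = w x := ENNReal.rpow_one _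
  have hkq : 1 / q * (k : ℝ) = (k - 1 : ℕ) := by
    rw [Nat.cast_sub (by omega), hq, Real.conjExponent]
    push_cast
    have : (k : ℝ) - 1 ≠ 0 := by linarith
    field_simp
  rw [h3]
  calc (∫⁻ x, ((fun x => f x * (w x)⁻¹) * w) x ∂μ) ^ k
      ≤ ((∫⁻ x, (f x * (w x)⁻¹) ^ (k : ℝ) ∂μ) ^ (1 / (k : ℝ)) *
          (∫⁻ x, w x ^ q ∂μ) ^ (1 / q)) ^ k := by gcongr; exact h2
    _ = (∫⁻ x, (f x * (w x)⁻¹) ^ (k : ℝ) ∂μ) * (∫⁻ x, w x ^ q ∂μ) ^ (k - 1) := by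
        rw [mul_pow, ← ENNReal.rpow_natCast, ← ENNReal.rpow_mul, one_div_mul_cancel hk0.ne',
          ENNReal.rpow_one, ← ENNReal.rpow_natCast _ k, ← ENNReal.rpow_mul, hkq,
          ENNReal.rpow_natCast]
    _ ≤ (∫⁻ x, (f x * (w x)⁻¹) ^ (k : ℝ) ∂μ) * (∫⁻ x, w x ∂μ) ^ (k - 1) := by gcongr
    _ = _ := by
        rw [mul_comm]
        congr 1
        exact lintegral_congr fun x => by rw [ENNReal.rpow_natCast, mul_pow]

/-- The weight `(1 + ‖x‖²)^{-N}`. -/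
noncomputable def japaneseWeight (N : ℕ) (x : EuclideanSpace ℝ κ) : ℝ≥0∞ :=
  ENNReal.ofReal ((1 + ‖x‖ ^ 2) ^ N)⁻¹

theorem measurable_japaneseWeight (N : ℕ) : Measurable (japaneseWeight (κ := κ) N) := by
  unfold japaneseWeight
  fun_prop

theorem lintegral_japaneseWeight_ne_top :
    ∫⁻ x, japaneseWeight (κ := κ) (Fintype.card κ + 1) x ≠ ∞ := by
  have h := integrable_rpow_neg_one_add_norm_sq (E := EuclideanSpace ℝ κ) (μ := volume)
    (r := 2 * (Fintype.card κ + 1)) (by simp; linarith [Nat.cast_nonneg (α := ℝ) (Fintype.card κ)])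
  refine ne_of_eq_of_ne (lintegral_congr fun x => ?_) h.lintegral_lt_top.ne
  rw [japaneseWeight]
  congr 1
  have : (-(2 * ((Fintype.card κ : ℝ) + 1)) / 2) = -((Fintype.card κ + 1 : ℕ) : ℝ) := by
    push_cast; ring
  rw [this, Real.rpow_neg (by positivity), Real.rpow_natCast]

theorem exists_lintegral_gaussIntegral_pow_le (k : ℕ) (hk : 2 ≤ k) :
    ∃ K : ℝ≥0∞, K ≠ ∞ ∧ ∀ᶠ J : ℕ in atTop, ∫⁻ x : Fin J → EuclideanSpace ℝ κ,
      gaussIntegral (empCov (fun i => (x i).ofLp) (fun i => (x i).ofLp)) ^ k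
      ∂Measure.pi (fun _ : Fin J => stdGaussian (EuclideanSpace ℝ κ)) ≤ K := by
  set d := Fintype.card κ + 1 with hd
  -- The part `d * k` cancels the `k`-th power of the inverse weight, and the remaining `d` leaves
  -- one integrable weight.
  set N := d * k + d with hN
  have hN0 : 0 < N := by positivity
  set I := ∫⁻ x, japaneseWeight (κ := κ) d x with hI
  have hItop : I ≠ ∞ := lintegral_japaneseWeight_ne_top
  refine ⟨I ^ (k - 1) * (ENNReal.ofReal ((4 * N) ^ N) * I), by finiteness, ?_⟩
  filter_upwards [eventually_ge_atTop (4 * N)] with J hJ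
  set Q := Measure.pi (fun _ : Fin J => stdGaussian (EuclideanSpace ℝ κ)) with hQ
  let q : (Fin J → EuclideanSpace ℝ κ) → EuclideanSpace ℝ κ → ℝ := fun x v =>
    v.ofLp ⬝ᵥ empCov (fun i => (x i).ofLp) (fun i => (x i).ofLp) *ᵥ v.ofLp
  have hq : Measurable (Function.uncurry q) := by
    simp only [Function.uncurry_def, q, dotProduct_empCov_mulVec]
    simp only [dotProduct]
    fun_prop
  have hw0 : ∀ v, japaneseWeight (κ := κ) d v ≠ 0 := fun v => by
    rw [japaneseWeight, ne_eq, ENNReal.ofReal_eq_zero, not_le]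
    positivity
  have hw1 : ∀ v, japaneseWeight (κ := κ) d v ≤ 1 := fun v => by
    rw [japaneseWeight, ← ENNReal.ofReal_one]
    refine ENNReal.ofReal_le_ofReal (inv_le_one_of_one_le₀ (one_le_pow₀ ?_))
    nlinarith [sq_nonneg ‖v‖]
  have hstep : ∀ x, gaussIntegral (empCov (fun i => (x i).ofLp) (fun i => (x i).ofLp)) ^ k ≤
      I ^ (k - 1) * ∫⁻ v, ENNReal.ofReal (Real.exp (-(k * q x v))) *
        ((japaneseWeight (κ := κ) d v)⁻¹) ^ k := fun x => by
    have hm : Measurable fun v => ENNReal.ofReal (Real.exp (-q x v)) :=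
      (hq.comp measurable_prodMk_left).neg.exp.ennreal_ofReal
    refine (lintegral_pow_le_mul_lintegral volume hm.aemeasurable
      (measurable_japaneseWeight d).aemeasurable hw1 hw0 hk).trans (le_of_eq ?_)
    congr 1
    refine lintegral_congr fun v => ?_
    rw [← ENNReal.ofReal_pow (Real.exp_pos _).le, ← Real.exp_nat_mul, mul_neg]
  have hmeas : Measurable (Function.uncurry fun x v => ENNReal.ofReal (Real.exp (-(k * q x v))) *
        ((japaneseWeight (κ := κ) d v)⁻¹) ^ k) :=
    ((hq.const_mul (k : ℝ)).neg.exp.ennreal_ofReal).mul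
      ((((measurable_japaneseWeight d).comp measurable_snd).inv).pow_const k)
  have hk1 : (1 : ℝ) ≤ k := by exact_mod_cast (by omega : 1 ≤ k)
  calc ∫⁻ x, gaussIntegral (empCov (fun i => (x i).ofLp) (fun i => (x i).ofLp)) ^ k ∂Q
      ≤ ∫⁻ x, (I ^ (k - 1) * ∫⁻ v, ENNReal.ofReal (Real.exp (-(k * q x v))) *
        ((japaneseWeight (κ := κ) d v)⁻¹) ^ k) ∂Q := lintegral_mono hstep
    _ = I ^ (k - 1) * ∫⁻ x, (∫⁻ v, ENNReal.ofReal (Real.exp (-(k * q x v))) *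
        ((japaneseWeight (κ := κ) d v)⁻¹) ^ k) ∂Q :=
        lintegral_const_mul _ hmeas.lintegral_prod_right'
    _ = I ^ (k - 1) * ∫⁻ v, (∫⁻ x, ENNReal.ofReal (Real.exp (-(k * q x v))) ∂Q) *
        ((japaneseWeight (κ := κ) d v)⁻¹) ^ k := by
        rw [lintegral_lintegral_swap hmeas.aemeasurable]
        congr 1
        refine lintegral_congr fun v => ?_
        rw [lintegral_mul_const]
        exact ((hq.comp measurable_prodMk_right).const_mul (k : ℝ)).neg.exp.ennreal_ofReal
    _ ≤ I ^ (k - 1) * ∫⁻ v, ENNReal.ofReal ((4 * N) ^ N) * japaneseWeight (κ := κ) d v := by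
        refine mul_le_mul_right (lintegral_mono fun v => ?_) _
        refine (mul_le_mul_left (lintegral_exp_neg_mul_empCov_le_pow hN0 hJ v hk1) _).trans
          (le_of_eq ?_)
        have hpos : 0 < (1 + ‖v‖ ^ 2) ^ d := by positivity
        rw [ENNReal.ofReal_mul (by positivity), mul_assoc]
        congr 1
        rw [japaneseWeight, ENNReal.ofReal_inv_of_pos hpos, inv_inv,
          ← ENNReal.ofReal_inv_of_pos hpos, ← ENNReal.ofReal_pow hpos.le,
          ← ENNReal.ofReal_mul (by positivity)]
        congr 1
        rw [hN, pow_add, pow_mul]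
        field_simp
    _ = _ := by rw [lintegral_const_mul _ (measurable_japaneseWeight d)]

theorem measurable_empCov_apply {κ : Type*} {J : ℕ} (a b : κ) :
    Measurable fun x : Fin J → EuclideanSpace ℝ κ =>
      empCov (fun i => (x i).ofLp) (fun i => (x i).ofLp) a b := by
  simp only [empCov_apply, vecMean]
  fun_prop

theorem measurable_det_of_apply [DecidableEq κ] {α : Type*} [MeasurableSpace α] {M : α → Matrix κ κ ℝ}
    (h : ∀ a b, Measurable fun x => M x a b) : Measurable fun x => (M x).det := by
  simp only [Matrix.det_apply']
  exact Finset.measurable_fun_sum _ fun σ _ =>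
    (Finset.measurable_fun_prod _ fun i _ => h _ _).const_mul _

theorem measurable_gaussIntegral_empCov {J : ℕ} :
    Measurable fun x : Fin J → EuclideanSpace ℝ κ =>
      gaussIntegral (empCov (fun i => (x i).ofLp) (fun i => (x i).ofLp)) := by
  have hq : Measurable fun p : (Fin J → EuclideanSpace ℝ κ) × EuclideanSpace ℝ κ =>
      ENNReal.ofReal (Real.exp (-(p.2.ofLp ⬝ᵥ
        empCov (fun i => (p.1 i).ofLp) (fun i => (p.1 i).ofLp) *ᵥ p.2.ofLp))) := by
    simp only [dotProduct_empCov_mulVec]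
    simp only [dotProduct]
    fun_prop
  exact hq.lintegral_prod_right'

variable [DecidableEq κ] {Ω : ℕ → Type*} [∀ J, MeasurableSpace (Ω J)] {P : ∀ J, Measure (Ω J)}
  {X : ∀ J, Fin J → Ω J → EuclideanSpace ℝ κ}

/-- A finite second moment makes the Gaussian integral finite almost surely, which excludes singular
covariances. -/
theorem eventually_posDef_empCov
    (hX : ∀ J i, HasLaw (X J i) (stdGaussian (EuclideanSpace ℝ κ)) (P J))
    (hindep : ∀ J, iIndepFun (X J) (P J)) :
    ∀ᶠ J in atTop, ∀ᵐ ω ∂P J,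
      (empCov (fun i => (X J i ω).ofLp) (fun i => (X J i ω).ofLp)).PosDef := by
  obtain ⟨K, hK, h⟩ := exists_lintegral_gaussIntegral_pow_le (κ := κ) 2 le_rfl
  filter_upwards [h, eventually_ge_atTop 1] with J hJ hJ1
  have hae := ae_lt_top (measurable_gaussIntegral_empCov.pow_const 2)
    (ne_top_of_le_ne_top hK hJ)
  have hlaw := (hindep J).hasLaw_pi (hX J)
  rw [← hlaw.map_eq] at hae
  filter_upwards [ae_of_ae_map hlaw.aemeasurable hae] with ω hω
  have hpsd := posSemidef_empCov (fun i => (X J i ω).ofLp) hJ1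
  rw [hpsd.posDef_iff_isUnit]
  refine (Matrix.isUnit_iff_isUnit_det _).mpr (isUnit_iff_ne_zero.mpr
    (det_ne_zero_of_gaussIntegral_ne_top hpsd fun htop => ?_))
  simp [htop] at hω

theorem lpRate_inv_det_empCov
    (hX : ∀ J i, HasLaw (X J i) (stdGaussian (EuclideanSpace ℝ κ)) (P J))
    (hindep : ∀ J, iIndepFun (X J) (P J)) :
    LpRate P (fun J ω => (empCov (fun i => (X J i ω).ofLp) (fun i => (X J i ω).ofLp)).det⁻¹) 1 := by
  intro k
  have hm : ∀ J, Measurable fun x : Fin J → EuclideanSpace ℝ κ =>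
      (empCov (fun i => (x i).ofLp) (fun i => (x i).ofLp)).det⁻¹ := fun J =>
    (measurable_det_of_apply measurable_empCov_apply).inv
  have hlaw : ∀ J, HasLaw (fun ω i => X J i ω)
      (Measure.pi fun _ : Fin J => stdGaussian (EuclideanSpace ℝ κ)) (P J) := fun J =>
    (hindep J).hasLaw_pi (hX J)
  have hmeas : ∀ J, AEStronglyMeasurable (fun ω =>
      (empCov (fun i => (X J i ω).ofLp) (fun i => (X J i ω).ofLp)).det⁻¹) (P J) := fun J =>
    ((hm J).comp_aemeasurable (hlaw J).aemeasurable).aestronglyMeasurable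
  rcases Nat.eq_zero_or_pos k with rfl | hk
  · exact ⟨0, Eventually.of_forall fun J => ⟨hmeas J, by simp⟩⟩
  obtain ⟨K, hK, h⟩ := exists_lintegral_gaussIntegral_pow_le (κ := κ) (2 * k) (by omega)
  set C := ((gaussIntegral (1 : Matrix κ κ ℝ))⁻¹ ^ (2 * k) * K) ^ (1 / (k : ℝ)) with hC
  have hCtop : C ≠ ∞ := by
    have := gaussIntegral_one_pos (κ := κ)
    exact ENNReal.rpow_ne_top_of_nonneg (by positivity)
      (ENNReal.mul_ne_top (ENNReal.pow_ne_top (ENNReal.inv_ne_top.mpr this)) hK)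
  refine ⟨C.toNNReal, ?_⟩
  filter_upwards [h, eventually_ge_atTop 1] with J hJ hJ1
  refine ⟨hmeas J, ?_⟩
  rw [ENNReal.coe_toNNReal hCtop, Pi.one_apply, ENNReal.coe_one, mul_one]
  refine eLpNorm_natCast_le hk.ne' ?_
  rw [(hlaw J).lintegral_comp (f := fun x => ‖(empCov (fun i => (x i).ofLp)
    (fun i => (x i).ofLp)).det⁻¹‖ₑ ^ k) ((hm J).enorm.pow_const k).aemeasurable]
  calc _ ≤ ∫⁻ x : Fin J → EuclideanSpace ℝ κ, (gaussIntegral (1 : Matrix κ κ ℝ))⁻¹ ^ (2 * k) *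
        gaussIntegral (empCov (fun i => (x i).ofLp) (fun i => (x i).ofLp)) ^ (2 * k)
        ∂Measure.pi fun _ : Fin J => stdGaussian (EuclideanSpace ℝ κ) :=
        lintegral_mono fun x => inv_det_pow_le_gaussIntegral (posSemidef_empCov _ hJ1) hk.ne'
    _ ≤ _ := by
        rw [lintegral_const_mul _ (measurable_gaussIntegral_empCov.pow_const _)]
        gcongr

end InverseMoments

/-! ### Trace and determinant inequalities -/

section DivergenceBound

variable {ι : Type*} [Fintype ι] [DecidableEq ι]

/-- Sum `log x ≤ x - 1` over the eigenvalues. -/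
theorem log_det_le_trace_sub_card {C : Matrix ι ι ℝ} (hC : C.PosDef) :
    Real.log C.det ≤ C.trace - Fintype.card ι := by
  rw [hC.isHermitian.det_eq_prod_eigenvalues, hC.isHermitian.trace_eq_sum_eigenvalues]
  simp only [RCLike.ofReal_real_eq_id, id_eq]
  rw [Real.log_prod fun i _ => (hC.eigenvalues_pos i).ne']
  calc ∑ i, Real.log (hC.isHermitian.eigenvalues i)
      ≤ ∑ i, (hC.isHermitian.eigenvalues i - 1) :=
        Finset.sum_le_sum fun i _ => Real.log_le_sub_one_of_pos (hC.eigenvalues_pos i)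
    _ = _ := by simp

theorem neg_log_det_le_trace_inv_sub_card {C : Matrix ι ι ℝ} (hC : C.PosDef) :
    -Real.log C.det ≤ C⁻¹.trace - Fintype.card ι := by
  have h := log_det_le_trace_sub_card hC.inv
  rwa [Matrix.det_nonsing_inv, Ring.inverse_eq_inv', Real.log_inv] at h

/-- The matrix form of `x + x⁻¹ - 2 = (x - 1)² / x`; it makes the symmetrized divergence quadratic
in the error `C - 1`. -/
theorem trace_add_trace_inv {C : Matrix ι ι ℝ} (hC : C.PosDef) :
    C.trace + C⁻¹.trace - 2 * Fintype.card ι = ((C - 1) * C⁻¹ * (C - 1)).trace := by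
  have hu : IsUnit C.det := isUnit_iff_ne_zero.mpr hC.det_pos.ne'
  have : (C - 1) * C⁻¹ * (C - 1) = C - 1 - 1 + C⁻¹ := by
    rw [Matrix.sub_mul, Matrix.mul_nonsing_inv _ hu, Matrix.one_mul, Matrix.sub_mul,
      Matrix.one_mul, Matrix.mul_sub, Matrix.nonsing_inv_mul _ hu, Matrix.mul_one]
    abel
  rw [this]
  simp only [Matrix.trace_add, Matrix.trace_sub, Matrix.trace_one]
  ring

theorem dotProduct_inv_mulVec_nonneg {C : Matrix ι ι ℝ} (hC : C.PosDef) (m : ι → ℝ) :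
    0 ≤ m ⬝ᵥ C⁻¹ *ᵥ m := by
  simpa using hC.inv.posSemidef.dotProduct_mulVec_nonneg m

end DivergenceBound

/-- Measurability of the divergence is inherited from the closed formula `f`, while its size is
controlled by `g`. An upper bound on `f` suffices, since `ENNReal.ofReal` discards negative values.
-/
theorem TendstoZeroInL2WithRate.of_le {Ω : ℕ → Type*} [∀ J, MeasurableSpace (Ω J)]
    {P : ∀ J, Measure (Ω J)} {D : ∀ J, Ω J → ℝ≥0∞} {f g : ∀ J, Ω J → ℝ}
    (hf : ∀ᶠ J in atTop, AEStronglyMeasurable (f J) (P J))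
    (hD : ∀ᶠ J in atTop, D J =ᵐ[P J] fun ω => ENNReal.ofReal (f J ω))
    (hfg : ∀ᶠ J in atTop, ∀ᵐ ω ∂P J, f J ω ≤ g J ω) (hg : LpRate P g (fun J => (J : ℝ≥0)⁻¹)) :
    TendstoZeroInL2WithRate P D (fun J => (J : ℝ)⁻¹) := by
  obtain ⟨K, hK⟩ := hg 2
  have hle : ∀ᶠ J : ℕ in atTop, eLpNorm (D J) 2 (P J) ≤ ((K * (J : ℝ≥0)⁻¹ : ℝ≥0) : ℝ≥0∞) := by
    filter_upwards [hD, hfg, hK] with J h1 h2 h3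
    have h4 : eLpNorm (D J) 2 (P J) ≤ eLpNorm (g J) 2 (P J) := by
      refine eLpNorm_mono_enorm_ae ?_
      filter_upwards [h1, h2] with ω h5 h6
      rw [h5, enorm_eq_self, Real.enorm_eq_ofReal_abs]
      exact ENNReal.ofReal_le_ofReal (h6.trans (le_abs_self _))
    rw [ENNReal.coe_mul]
    exact h4.trans (by simpa using h3.2)
  refine ⟨?_, ?_, ?_⟩
  · filter_upwards [hf, hD, hle] with J h1 h2 h3
    exact ⟨(h1.aemeasurable.ennreal_ofReal.congr h2.symm).aestronglyMeasurable,
      h3.trans_lt ENNReal.coe_lt_top⟩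
  · refine tendsto_of_tendsto_of_tendsto_of_le_of_le' tendsto_const_nhds ?_
      (Eventually.of_forall fun J => bot_le) hle
    rw [← ENNReal.coe_zero, ENNReal.tendsto_coe]
    have : Tendsto (fun J : ℕ => K * (J : ℝ≥0)⁻¹) atTop (𝓝 (K * 0)) :=
      (tendsto_inv_atTop_zero.comp tendsto_natCast_atTop_atTop).const_mul K
    rwa [mul_zero] at this
  · refine IsBigO.of_bound K ?_
    filter_upwards [hle] with J hJ
    have := ENNReal.toReal_mono ENNReal.coe_ne_top hJ
    rw [Real.norm_of_nonneg ENNReal.toReal_nonneg, Real.norm_of_nonneg (by positivity)]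
    simpa using this

/-! ### From moment rates to divergence rates -/

section Image

variable {ι κ : Type*} [Fintype ι] [DecidableEq ι] [Fintype κ] [DecidableEq κ]
  {Ω : ℕ → Type*} [∀ J, MeasurableSpace (Ω J)] {P : ∀ J, Measure (Ω J)}
  [∀ J, IsProbabilityMeasure (P J)]

theorem LpRate.eventually_aestronglyMeasurable {Ω : ℕ → Type*} [∀ J, MeasurableSpace (Ω J)]
    {P : ∀ J, Measure (Ω J)} {f : ∀ J, Ω J → ℝ} {r : ℕ → ℝ≥0} (h : LpRate P f r) :
    ∀ᶠ J in atTop, AEStronglyMeasurable (f J) (P J) := by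
  obtain ⟨K, hK⟩ := h 0
  exact hK.mono fun J hJ => hJ.1

theorem LpRate.bdd_of_sub {f : ∀ J, Ω J → ℝ} {c : ℝ}
    (h : LpRate P (fun J ω => f J ω - c) (fun J => (NNReal.sqrt J)⁻¹)) : LpRate P f 1 := by
  have h1 : LpRate P (fun J ω => f J ω - c) 1 := by
    refine h.mono_rate 1 ?_
    filter_upwards [eventually_ge_atTop 1] with J hJ
    rw [one_mul]
    exact inv_le_one_of_one_le₀ (NNReal.one_le_sqrt.mpr (by exact_mod_cast hJ))
  simpa using h1.add (LpRate.const c)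

/-- If `m J` and `C J - 1` tend to zero at rate `J^{-1/2}` in all `Lᵏ` and the inverse of `det C J`
is bounded in all `Lᵏ`, then both divergences between the image of `N(m J, C J)` under
`x ↦ b + A x` and that of the standard Gaussian measure tend to zero in `L²` at rate `J⁻¹`. -/
theorem tendstoZeroInL2WithRate_klDiv_image {A : Matrix κ ι ℝ} {B : Matrix ι κ ℝ} (hBA : B * A = 1)
    (b : EuclideanSpace ℝ κ) {m : ∀ J, Ω J → ι → ℝ} {C : ∀ J, Ω J → Matrix ι ι ℝ}
    (hm : ∀ a, LpRate P (fun J ω => m J ω a) (fun J => (NNReal.sqrt J)⁻¹))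
    (hC : ∀ a c, LpRate P (fun J ω => C J ω a c - (1 : Matrix ι ι ℝ) a c)
      (fun J => (NNReal.sqrt J)⁻¹))
    (hdet : LpRate P (fun J ω => (C J ω).det⁻¹) 1)
    (hpos : ∀ᶠ J in atTop, ∀ᵐ ω ∂P J, (C J ω).PosDef)
    {m' : ∀ J, Ω J → EuclideanSpace ℝ κ} {C' : ∀ J, Ω J → Matrix κ κ ℝ}
    (hm' : ∀ᶠ J in atTop, ∀ᵐ ω ∂P J, m' J ω = b + WithLp.toLp 2 (A *ᵥ m J ω))
    (hC' : ∀ᶠ J in atTop, ∀ᵐ ω ∂P J, C' J ω = A * C J ω * Aᵀ) :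
    TendstoZeroInL2WithRate P
      (fun J ω => klDiv (multivariateGaussian (m' J ω) (C' J ω))
        (multivariateGaussian b (A * Aᵀ))) (fun J => (J : ℝ)⁻¹) ∧
    TendstoZeroInL2WithRate P
      (fun J ω => klDiv (multivariateGaussian b (A * Aᵀ))
        (multivariateGaussian (m' J ω) (C' J ω))) (fun J => (J : ℝ)⁻¹) := by
  have hC1 : ∀ a c, LpRate P (fun J ω => C J ω a c) 1 := fun a c => (hC a c).bdd_of_sub
  have hinv : ∀ a c, LpRate P (fun J ω => (C J ω)⁻¹ a c) 1 := LpRate.matrix_inv hC1 hdet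
  have hrate : (fun J : ℕ => (NNReal.sqrt J)⁻¹ * (NNReal.sqrt J)⁻¹) =
      fun J : ℕ => (J : ℝ≥0)⁻¹ := funext fun J => by
    rw [← mul_inv, NNReal.mul_self_sqrt]
  have hone : ∀ J : ℕ, (1 : ℕ → ℝ≥0) J = 1 := fun _ => rfl
  have hmm : LpRate P (fun J ω => ∑ a, m J ω a * m J ω a) (fun J => (J : ℝ≥0)⁻¹) :=
    hrate ▸ LpRate.sum _ fun a _ => (hm a).mul (hm a)
  have hmCm : LpRate P (fun J ω => m J ω ⬝ᵥ (C J ω)⁻¹ *ᵥ m J ω) (fun J => (J : ℝ≥0)⁻¹) := by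
    have h1 := LpRate.mulVec hinv hm
    simp only [hone, one_mul] at h1
    exact hrate ▸ LpRate.sum _ fun a _ => (hm a).mul (h1 a)
  have htr : LpRate P (fun J ω => ((C J ω - 1) * (C J ω)⁻¹ * (C J ω - 1)).trace)
      (fun J => (J : ℝ≥0)⁻¹) := by
    have h1 := LpRate.matrix_mul (M := fun J ω => C J ω - 1) hC hinv
    simp only [hone, mul_one] at h1
    have h2 := LpRate.matrix_mul h1 (N := fun J ω => C J ω - 1) hC
    rw [hrate] at h2
    exact LpRate.sum _ fun a _ => h2 a a
  -- This is the sum of the two divergences. It bounds each of them because the other is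
  -- nonnegative.
  have hbound := ((hmm.add hmCm).add htr).const_mul (1 / 2)
  have hlog : ∀ᶠ J in atTop, AEStronglyMeasurable (fun ω => Real.log (C J ω).det) (P J) :=
    (LpRate.det hC1).eventually_aestronglyMeasurable.mono fun J h =>
      h.aemeasurable.log.aestronglyMeasurable
  have htrC : LpRate P (fun J ω => (C J ω).trace) 1 := LpRate.sum _ fun a _ => hC1 a a
  have htrI : LpRate P (fun J ω => (C J ω)⁻¹.trace) 1 := LpRate.sum _ fun a _ => hinv a a
  constructor
  · refine TendstoZeroInL2WithRate.of_le (f := fun J ω => (∑ a, m J ω a * m J ω a +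
      (C J ω).trace - Fintype.card ι - Real.log (C J ω).det) / 2) ?_ ?_ ?_ hbound
    · filter_upwards [hmm.eventually_aestronglyMeasurable, htrC.eventually_aestronglyMeasurable,
        hlog] with J h1 h2 h3
      exact (((h1.aemeasurable.add h2.aemeasurable).sub_const _).sub
        h3.aemeasurable).div_const 2 |>.aestronglyMeasurable
    · filter_upwards [hpos, hm', hC'] with J h1 h2 h3
      filter_upwards [h1, h2, h3] with ω h1 h2 h3
      rw [h2, h3]
      refine (klDiv_multivariateGaussian_image hBA b (WithLp.toLp 2 (m J ω)) h1).trans ?_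
      rw [EuclideanSpace.real_norm_sq_eq]
      simp only [sq]
    · filter_upwards [hpos] with J h1
      filter_upwards [h1] with ω h1
      have e1 := neg_log_det_le_trace_inv_sub_card h1
      have e2 := dotProduct_inv_mulVec_nonneg h1 (m J ω)
      have e3 := trace_add_trace_inv h1
      linarith
  · refine TendstoZeroInL2WithRate.of_le (f := fun J ω => (m J ω ⬝ᵥ (C J ω)⁻¹ *ᵥ m J ω +
      (C J ω)⁻¹.trace - Fintype.card ι + Real.log (C J ω).det) / 2) ?_ ?_ ?_ hbound
    · filter_upwards [hmCm.eventually_aestronglyMeasurable, htrI.eventually_aestronglyMeasurable,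
        hlog] with J h1 h2 h3
      exact (((h1.aemeasurable.add h2.aemeasurable).sub_const _).add
        h3.aemeasurable).div_const 2 |>.aestronglyMeasurable
    · filter_upwards [hpos, hm', hC'] with J h1 h2 h3
      filter_upwards [h1, h2, h3] with ω h1 h2 h3
      rw [h2, h3]
      exact klDiv_multivariateGaussian_image_right hBA b (WithLp.toLp 2 (m J ω)) h1
    · filter_upwards [hpos] with J h1
      filter_upwards [h1] with ω h1
      have e1 := log_det_le_trace_sub_card h1
      have e2 : 0 ≤ ∑ a, m J ω a * m J ω a := Finset.sum_nonneg fun a _ => mul_self_nonneg _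
      have e3 := trace_add_trace_inv h1
      linarith

end Image

/-! ### Pseudoinverses and injective factors of semidefinite matrices -/

theorem pinv_eq_inv {κ : Type*} [Fintype κ] [DecidableEq κ] {A : Matrix κ κ ℝ} (hA : A.det ≠ 0) :
    pinv A = A⁻¹ := by
  have hu : IsUnit A.det := isUnit_iff_ne_zero.mpr hA
  refine (isMoorePenroseInverse_pinv A).unique ⟨?_, ?_, ?_, ?_⟩ <;>
    simp [Matrix.mul_nonsing_inv _ hu, Matrix.nonsing_inv_mul _ hu]

/-- A positive semidefinite real matrix is `A Aᵀ` for some `A` with a left inverse. -/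
theorem Matrix.PosSemidef.exists_mul_transpose_eq_leftInverse {κ : Type*} [Fintype κ]
    [DecidableEq κ] {S : Matrix κ κ ℝ} (hS : S.PosSemidef) :
    ∃ (s : Finset κ) (A : Matrix κ s ℝ) (B : Matrix s κ ℝ), B * A = 1 ∧ A * Aᵀ = S := by
  classical
  set U : Matrix κ κ ℝ := (hS.isHermitian.eigenvectorUnitary).1 with hU
  set v := hS.isHermitian.eigenvalues with hv
  have hUU : Uᵀ * U = 1 := by
    have := Unitary.coe_star_mul_self hS.isHermitian.eigenvectorUnitary
    rwa [Matrix.star_eq_conjTranspose, Matrix.conjTranspose_eq_transpose_of_trivial] at this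
  have hsp : S = U * Matrix.diagonal v * Uᵀ := by
    have := hS.isHermitian.spectral_theorem
    rw [Unitary.conjStarAlgAut_apply, Matrix.star_eq_conjTranspose,
      Matrix.conjTranspose_eq_transpose_of_trivial] at this
    exact this
  -- Keep only the eigenvectors with nonzero eigenvalue, scaled by its square root; the left inverse
  -- rescales back.
  refine ⟨Finset.univ.filter fun k => v k ≠ 0, Matrix.of fun i k => U i k * √(v k),
    Matrix.of fun k i => (√(v k))⁻¹ * U i k, ?_, ?_⟩
  · ext k l
    have h1 := congrFun (congrFun hUU k) l
    rw [Matrix.mul_apply] at h1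
    simp only [Matrix.transpose_apply] at h1
    have h2 : √(v k) ≠ 0 :=
      (Real.sqrt_pos.mpr ((hS.eigenvalues_nonneg k).lt_of_ne'
        (Finset.mem_filter.mp k.2).2)).ne'
    rw [Matrix.mul_apply]
    simp only [Matrix.of_apply]
    calc ∑ i, (√(v k))⁻¹ * U i k * (U i l * √(v l))
        = (√(v k))⁻¹ * √(v l) * ∑ i, U i k * U i l := by
          rw [Finset.mul_sum]
          exact Finset.sum_congr rfl fun i _ => by ring
      _ = _ := by
          rw [h1, Matrix.one_apply, Matrix.one_apply]
          by_cases h : k = l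
          · subst h
            simp [h2]
          · have : (k : κ) ≠ l := fun h' => h (Subtype.ext h')
            simp [h, this]
  · ext i j
    rw [hsp, Matrix.mul_apply, Matrix.mul_apply]
    simp only [Matrix.of_apply, Matrix.transpose_apply, Matrix.mul_diagonal]
    rw [Finset.sum_coe_sort (Finset.univ.filter fun k => v k ≠ 0)
      (fun k => U i k * √(v k) * (U j k * √(v k)))]
    rw [Finset.sum_filter]
    refine Finset.sum_congr rfl fun k _ => ?_
    have := Real.mul_self_sqrt (hS.eigenvalues_nonneg k)
    split_ifs with h
    · calc _ = U i k * U j k * (√(v k) * √(v k)) := by ring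
        _ = _ := by rw [hv, this]; ring
    · rw [not_not] at h
      simp [h]

theorem posSemidef_mul_transpose_self {ι κ : Type*} [Fintype ι] [Finite κ] (M : Matrix κ ι ℝ) :
    (M * Mᵀ).PosSemidef := by
  have := Matrix.posSemidef_self_mul_conjTranspose M
  rwa [Matrix.conjTranspose_eq_transpose_of_trivial] at this

/-! ### Standardization of Gaussian samples -/

section Standardization

variable {ι κ : Type*} [Fintype ι] [DecidableEq ι] [Fintype κ] [DecidableEq κ]
  {Ω : Type*} [MeasurableSpace Ω] {P : Measure Ω} {X : Ω → EuclideanSpace ℝ κ}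
  {μ : EuclideanSpace ℝ κ} {M : Matrix κ ι ℝ} {N : Matrix ι κ ℝ}

theorem multivariateGaussian_zero_cov (b : EuclideanSpace ℝ κ) :
    multivariateGaussian b (0 : Matrix κ κ ℝ) = Measure.dirac b := by
  have h := map_add_mulVec_stdGaussian (0 : Matrix κ κ ℝ) b
  rw [Matrix.zero_mul] at h
  rw [← h]
  simp [Measure.map_const]

theorem ProbabilityTheory.HasLaw.add_mulVec {S : Matrix κ κ ℝ} (hS : S.PosSemidef)
    (hX : HasLaw X (multivariateGaussian μ S) P) (A : Matrix ι κ ℝ) (b : EuclideanSpace ℝ ι) :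
    HasLaw (fun ω => b + WithLp.toLp 2 (A *ᵥ (X ω).ofLp))
      (multivariateGaussian (b + WithLp.toLp 2 (A *ᵥ μ.ofLp)) (A * S * Aᵀ)) P := by
  rw [← map_add_mulVec_multivariateGaussian A b μ hS]
  exact HasLaw.fun_comp (Y := fun x : EuclideanSpace ℝ κ => b + WithLp.toLp 2 (A *ᵥ x.ofLp))
    ⟨(measurable_add_mulVec A b).aemeasurable, rfl⟩ hX

theorem ProbabilityTheory.HasLaw.standardize (hX : HasLaw X (multivariateGaussian μ (M * Mᵀ)) P)
    (hNM : N * M = 1) :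
    HasLaw (fun ω => -WithLp.toLp 2 (N *ᵥ μ.ofLp) + WithLp.toLp 2 (N *ᵥ (X ω).ofLp))
      (stdGaussian (EuclideanSpace ℝ ι)) P := by
  have h := hX.add_mulVec (posSemidef_mul_transpose_self M) N (-WithLp.toLp 2 (N *ᵥ μ.ofLp))
  rwa [neg_add_cancel, ← Matrix.mul_assoc, hNM, Matrix.one_mul, ← Matrix.transpose_mul, hNM,
    Matrix.transpose_one, multivariateGaussian_zero_one] at h

/-- `1 - M N` annihilates `M`, so `(1 - M N) (X - μ)` is Gaussian with zero mean and covariance,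
hence zero almost surely: a degenerate sample stays in `μ + range M`. -/
theorem ProbabilityTheory.HasLaw.ae_eq_add_mulVec_standardize
    (hX : HasLaw X (multivariateGaussian μ (M * Mᵀ)) P) (hNM : N * M = 1) :
    ∀ᵐ ω ∂P, X ω = μ + WithLp.toLp 2 (M *ᵥ
      (-WithLp.toLp 2 (N *ᵥ μ.ofLp) + WithLp.toLp 2 (N *ᵥ (X ω).ofLp) :
        EuclideanSpace ℝ ι).ofLp) := by
  have h0 : (1 - M * N) * (M * Mᵀ) * (1 - M * N)ᵀ = 0 := by
    have : (1 - M * N) * (M * Mᵀ) = 0 := by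
      rw [Matrix.sub_mul, Matrix.one_mul, Matrix.mul_assoc, ← Matrix.mul_assoc N, hNM,
        Matrix.one_mul, sub_self]
    rw [this, Matrix.zero_mul]
  have h1 := hX.add_mulVec (posSemidef_mul_transpose_self M) (1 - M * N)
    (-WithLp.toLp 2 ((1 - M * N) *ᵥ μ.ofLp))
  rw [neg_add_cancel, h0, multivariateGaussian_zero_cov] at h1
  filter_upwards [h1.ae_eq_of_dirac] with ω hω
  have h2 := congrArg WithLp.ofLp hω
  refine WithLp.ofLp_injective 2 ?_
  simp only [WithLp.ofLp_add, WithLp.ofLp_neg, WithLp.ofLp_zero, Matrix.sub_mulVec,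
    Matrix.one_mulVec, Matrix.mulVec_add, Matrix.mulVec_neg, Matrix.mulVec_mulVec] at h2 ⊢
  rw [← sub_eq_zero, ← h2]
  abel

end Standardization

/-! ### Sample moments under affine maps -/

section SampleMoments

variable {J p q : ℕ}

theorem sampleMean_eq (x : Fin J → EuclideanSpace ℝ (Fin p)) :
    sampleMean x = WithLp.toLp 2 (vecMean fun i => (x i).ofLp) := by
  ext a
  simp [sampleMean, vecMean]

theorem sampleCrossCov_eq (x : Fin J → EuclideanSpace ℝ (Fin p))
    (y : Fin J → EuclideanSpace ℝ (Fin q)) :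
    sampleCrossCov x y = empCov (fun i => (x i).ofLp) fun i => (y i).ofLp := by
  ext a b
  rw [empCov_apply]
  simp [sampleCrossCov, sampleMean_eq, Matrix.sum_apply, Matrix.vecMulVec_apply]

theorem sampleMean_affine {κ : Type*} [Fintype κ] (hJ : 0 < J) (b : EuclideanSpace ℝ (Fin p))
    (M : Matrix (Fin p) κ ℝ) (h : Fin J → κ → ℝ) :
    sampleMean (fun i => b + WithLp.toLp 2 (M *ᵥ h i)) =
      b + WithLp.toLp 2 (M *ᵥ vecMean h) := by
  rw [sampleMean_eq]
  simp only [WithLp.ofLp_add]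
  rw [vecMean_affine hJ, WithLp.toLp_add]

theorem sampleCrossCov_affine {κ : Type*} [Fintype κ] (hJ : 0 < J)
    (b : EuclideanSpace ℝ (Fin p)) (M : Matrix (Fin p) κ ℝ) (b' : EuclideanSpace ℝ (Fin q))
    (M' : Matrix (Fin q) κ ℝ) (h : Fin J → κ → ℝ) :
    sampleCrossCov (fun i => b + WithLp.toLp 2 (M *ᵥ h i))
      (fun i => b' + WithLp.toLp 2 (M' *ᵥ h i)) = M * empCov h h * M'ᵀ := by
  rw [sampleCrossCov_eq]
  exact empCov_affine hJ M b.ofLp h M' b'.ofLp h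

end SampleMoments

/-! ### Schur complements -/

section SchurComplement

variable {ι κ : Type*} [Fintype ι] [Fintype κ] [DecidableEq κ]
  {E : Matrix ι ι ℝ} {H : Matrix ι κ ℝ} {G : Matrix κ κ ℝ}

theorem posSemidef_schur (hF : (Matrix.fromBlocks E H Hᵀ G).PosSemidef) (hG : G.PosDef) :
    (E - H * G⁻¹ * Hᵀ).PosSemidef := by
  have : Invertible G := Matrix.invertibleOfIsUnitDet _ (isUnit_iff_ne_zero.mpr hG.det_pos.ne')
  have h := Matrix.PosDef.fromBlocks₂₂ E H hG
  rw [Matrix.conjTranspose_eq_transpose_of_trivial] at h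
  exact h.mp hF

theorem det_fromBlocks_eq_mul_det_schur [DecidableEq ι] (hG : G.det ≠ 0) :
    (Matrix.fromBlocks E H Hᵀ G).det = G.det * (E - H * G⁻¹ * Hᵀ).det := by
  have : Invertible G := Matrix.invertibleOfIsUnitDet _ (isUnit_iff_ne_zero.mpr hG)
  rw [Matrix.det_fromBlocks₂₂, Matrix.invOf_eq_nonsing_inv]

/-- Semidefiniteness passes to the Schur complement, and the determinant formula makes it
nonsingular. -/
theorem posDef_schur [DecidableEq ι] (hF : (Matrix.fromBlocks E H Hᵀ G).PosDef) (hG : G.PosDef) :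
    (E - H * G⁻¹ * Hᵀ).PosDef := by
  rw [(posSemidef_schur hF.posSemidef hG).posDef_iff_isUnit, Matrix.isUnit_iff_isUnit_det,
    isUnit_iff_ne_zero]
  intro h
  have := hF.det_pos
  rw [det_fromBlocks_eq_mul_det_schur hG.det_pos.ne', h, mul_zero] at this
  exact lt_irrefl _ this

end SchurComplement

theorem empCov_sum_eq_fromBlocks {J : ℕ} {ι κ : Type*} (h : Fin J → ι ⊕ κ → ℝ) :
    empCov h h = Matrix.fromBlocks (empCov (fun i a => h i (.inl a)) fun i a => h i (.inl a))
      (empCov (fun i a => h i (.inl a)) fun i a => h i (.inr a))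
      (empCov (fun i a => h i (.inl a)) fun i a => h i (.inr a))ᵀ
      (empCov (fun i a => h i (.inr a)) fun i a => h i (.inr a)) := by
  rw [empCov_transpose]
  ext (a | a) (b | b) <;> rfl

/-! ### Empirical conditional moments in standardized coordinates -/

section ConditionalMoments

variable {J p q : ℕ} {ι : Type*} [Fintype ι]
  {A : Matrix (Fin p) ι ℝ} {K : Matrix (Fin p) (Fin q) ℝ} {L : Matrix (Fin q) (Fin q) ℝ}

/-- This is the empirical regression coefficient: the exact one, `K`, plus an error linear in the
cross covariance `H` of the standardized parts. -/
theorem mul_mul_inv_conj {G : Matrix (Fin q) (Fin q) ℝ} (hL : L.det ≠ 0) (hG : G.det ≠ 0)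
    (H : Matrix ι (Fin q) ℝ) :
    (A * H * Lᵀ + K * L * G * Lᵀ) * (L * G * Lᵀ)⁻¹ = A * (H * G⁻¹) * L⁻¹ + K := by
  have hu : IsUnit L.det := isUnit_iff_ne_zero.mpr hL
  have hv : IsUnit G.det := isUnit_iff_ne_zero.mpr hG
  have ht : IsUnit Lᵀ.det := by rwa [Matrix.det_transpose]
  have hinv : (L * G * Lᵀ)⁻¹ = Lᵀ⁻¹ * G⁻¹ * L⁻¹ := by
    rw [Matrix.mul_inv_rev, Matrix.mul_inv_rev, Matrix.mul_assoc]
  have h1 : ∀ B : Matrix (Fin p) (Fin q) ℝ, B * Lᵀ * (L * G * Lᵀ)⁻¹ = B * G⁻¹ * L⁻¹ := fun B => by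
    rw [hinv, Matrix.mul_assoc, ← Matrix.mul_assoc Lᵀ, ← Matrix.mul_assoc Lᵀ,
      Matrix.mul_nonsing_inv _ ht, Matrix.one_mul, ← Matrix.mul_assoc]
  rw [Matrix.add_mul, h1, h1, Matrix.mul_assoc (K * L), Matrix.mul_nonsing_inv _ hv,
    Matrix.mul_one, Matrix.mul_assoc K, Matrix.mul_nonsing_inv _ hu, Matrix.mul_one]
  simp only [Matrix.mul_assoc]

variable (mY : EuclideanSpace ℝ (Fin p)) (mZ : EuclideanSpace ℝ (Fin q))
  (η : Fin J → ι → ℝ) (ζ : Fin J → Fin q → ℝ)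

theorem sampleCov_affine {κ : Type*} [Fintype κ] {p : ℕ} (hJ : 0 < J)
    (b : EuclideanSpace ℝ (Fin p)) (M : Matrix (Fin p) κ ℝ) (h : Fin J → κ → ℝ) :
    sampleCov (fun i => b + WithLp.toLp 2 (M *ᵥ h i)) = M * empCov h h * Mᵀ :=
  sampleCrossCov_affine hJ b M b M h

/-- The cross covariance of `A η + K L ζ` and `L ζ`. -/
theorem sampleCrossCov_of_factor (hJ : 0 < J) :
    sampleCrossCov (fun i => mY + WithLp.toLp 2 (A *ᵥ η i + (K * L) *ᵥ ζ i))
      (fun i => mZ + WithLp.toLp 2 (L *ᵥ ζ i)) =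
    A * empCov η ζ * Lᵀ + K * L * empCov ζ ζ * Lᵀ := by
  have h := sampleCrossCov_affine hJ mY (Matrix.fromCols A (K * L)) mZ
    (Matrix.fromCols (0 : Matrix (Fin q) ι ℝ) L) fun i => Sum.elim (η i) (ζ i)
  rw [empCov_sum_eq_fromBlocks] at h
  simpa [Matrix.fromCols_mul_fromBlocks, Matrix.transpose_fromCols, Matrix.fromCols_mul_fromRows,
    Matrix.add_mul] using h

theorem sampleCov_of_factor (hJ : 0 < J) :
    sampleCov (fun i => mY + WithLp.toLp 2 (A *ᵥ η i + (K * L) *ᵥ ζ i)) =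
    (A * empCov η η + K * L * (empCov η ζ)ᵀ) * Aᵀ +
      (A * empCov η ζ + K * L * empCov ζ ζ) * (K * L)ᵀ := by
  have h := sampleCov_affine hJ mY (Matrix.fromCols A (K * L)) fun i => Sum.elim (η i) (ζ i)
  rw [empCov_sum_eq_fromBlocks] at h
  simpa [Matrix.fromCols_mul_fromBlocks, Matrix.transpose_fromCols,
    Matrix.fromCols_mul_fromRows] using h

/-- Empirical regression on `ζ` removes `K L ζ` exactly, so only the residual of `A η` survives. -/
theorem sampleCondCov_of_factor (hJ : 0 < J) (hL : L.det ≠ 0) (hG : (empCov ζ ζ).det ≠ 0) :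
    sampleCondCov (fun i => mY + WithLp.toLp 2 (A *ᵥ η i + (K * L) *ᵥ ζ i))
      (fun i => mZ + WithLp.toLp 2 (L *ᵥ ζ i)) =
    A * (empCov η η - empCov η ζ * (empCov ζ ζ)⁻¹ * (empCov η ζ)ᵀ) * Aᵀ := by
  have hS : (L * empCov ζ ζ * Lᵀ).det ≠ 0 := by
    rw [Matrix.det_mul, Matrix.det_mul, Matrix.det_transpose]
    exact mul_ne_zero (mul_ne_zero hL hG) hL
  have hu : IsUnit L.det := isUnit_iff_ne_zero.mpr hL
  have hv : IsUnit (empCov ζ ζ).det := isUnit_iff_ne_zero.mpr hG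
  rw [sampleCondCov, sampleCov_affine hJ, pinv_eq_inv hS, sampleCrossCov_of_factor _ _ _ _ hJ,
    sampleCov_of_factor _ _ _ hJ, mul_mul_inv_conj hL hG]
  have hGt : (empCov ζ ζ)ᵀ = empCov ζ ζ := empCov_transpose ζ ζ
  generalize empCov η ζ = H
  have h1 : L⁻¹ * (L * (empCov ζ ζ * (Lᵀ * Kᵀ))) = empCov ζ ζ * (Lᵀ * Kᵀ) := by
    rw [← Matrix.mul_assoc, Matrix.nonsing_inv_mul _ hu, Matrix.one_mul]
  have h2 : L⁻¹ * (L * (Hᵀ * Aᵀ)) = Hᵀ * Aᵀ := by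
    rw [← Matrix.mul_assoc, Matrix.nonsing_inv_mul _ hu, Matrix.one_mul]
  have h3 : (empCov ζ ζ)⁻¹ * (empCov ζ ζ * (Lᵀ * Kᵀ)) = Lᵀ * Kᵀ := by
    rw [← Matrix.mul_assoc, Matrix.nonsing_inv_mul _ hv, Matrix.one_mul]
  simp only [Matrix.transpose_add, Matrix.transpose_mul, Matrix.transpose_transpose, hGt,
    Matrix.add_mul, Matrix.mul_add, Matrix.mul_sub, Matrix.sub_mul, Matrix.mul_assoc, h1, h2, h3]
  abel

/-- The first two summands form the exact conditional mean when `K = CYZ CZ⁻¹`; the error lies in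
the range of `A`, as the comparison of possibly degenerate laws requires. -/
theorem sampleCondMean_of_factor (hJ : 0 < J) (hL : L.det ≠ 0) (hG : (empCov ζ ζ).det ≠ 0)
    (z : EuclideanSpace ℝ (Fin q)) :
    sampleCondMean (fun i => mY + WithLp.toLp 2 (A *ᵥ η i + (K * L) *ᵥ ζ i))
      (fun i => mZ + WithLp.toLp 2 (L *ᵥ ζ i)) z =
    mY + WithLp.toLp 2 (K *ᵥ (z - mZ).ofLp) + WithLp.toLp 2 (A *ᵥ (vecMean η +
      (empCov η ζ * (empCov ζ ζ)⁻¹) *ᵥ (L⁻¹ *ᵥ (z - mZ).ofLp - vecMean ζ))) := by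
  have hS : (L * empCov ζ ζ * Lᵀ).det ≠ 0 := by
    rw [Matrix.det_mul, Matrix.det_mul, Matrix.det_transpose]
    exact mul_ne_zero (mul_ne_zero hL hG) hL
  have hu : IsUnit L.det := isUnit_iff_ne_zero.mpr hL
  have hmean : sampleMean (fun i => mY + WithLp.toLp 2 (A *ᵥ η i + (K * L) *ᵥ ζ i)) =
      mY + WithLp.toLp 2 (A *ᵥ vecMean η + (K * L) *ᵥ vecMean ζ) := by
    have h := sampleMean_affine hJ mY (Matrix.fromCols A (K * L)) fun i => Sum.elim (η i) (ζ i)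
    have h' : vecMean (fun i => Sum.elim (η i) (ζ i)) = Sum.elim (vecMean η) (vecMean ζ) := by
      ext (a | a) <;> rfl
    rw [h'] at h
    simpa only [Matrix.fromCols_mulVec_sumElim] using h
  rw [sampleCondMean, sampleCov_affine hJ, pinv_eq_inv hS, sampleCrossCov_of_factor _ _ _ _ hJ,
    mul_mul_inv_conj hL hG, hmean, sampleMean_affine hJ]
  refine WithLp.ofLp_injective 2 ?_
  simp only [WithLp.ofLp_add, WithLp.ofLp_sub, Matrix.add_mulVec, Matrix.mulVec_add,
    Matrix.mulVec_sub, Matrix.mulVec_mulVec]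
  rw [Matrix.add_mul, Matrix.mul_assoc (A * _) L⁻¹ L, Matrix.nonsing_inv_mul _ hu, Matrix.mul_one,
    Matrix.add_mulVec]
  simp only [Matrix.mul_assoc]
  abel

end ConditionalMoments

/-! ### Block triangular factorization of the joint covariance -/

section Factorization

variable {p q : ℕ} {CY : Matrix (Fin p) (Fin p) ℝ} {CYZ : Matrix (Fin p) (Fin q) ℝ}
  {CZ : Matrix (Fin q) (Fin q) ℝ}

theorem fromBlocks_factor {ι : Type*} [Fintype ι] {A : Matrix (Fin p) ι ℝ}
    {L : Matrix (Fin q) (Fin q) ℝ} (hCZ : CZ.PosDef) (hA : A * Aᵀ = condCov CY CYZ CZ)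
    (hL : L * Lᵀ = CZ) :
    Matrix.fromBlocks A (CYZ * CZ⁻¹ * L) 0 L * (Matrix.fromBlocks A (CYZ * CZ⁻¹ * L) 0 L)ᵀ =
      Matrix.fromBlocks CY CYZ CYZᵀ CZ := by
  have hu : IsUnit CZ.det := isUnit_iff_ne_zero.mpr hCZ.det_pos.ne'
  have hsymm : CZᵀ = CZ := by rw [← hL, Matrix.transpose_mul, Matrix.transpose_transpose]
  have h1 : CYZ * CZ⁻¹ * L * (CYZ * CZ⁻¹ * L)ᵀ = CYZ * CZ⁻¹ * CYZᵀ := by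
    calc CYZ * CZ⁻¹ * L * (CYZ * CZ⁻¹ * L)ᵀ = CYZ * (CZ⁻¹ * (L * Lᵀ)) * (CZ⁻¹)ᵀ * CYZᵀ := by
          simp only [Matrix.transpose_mul, Matrix.mul_assoc]
      _ = _ := by
          rw [hL, Matrix.nonsing_inv_mul _ hu, Matrix.mul_one, Matrix.transpose_nonsing_inv, hsymm]
  have h2 : CYZ * CZ⁻¹ * L * Lᵀ = CYZ := by
    rw [Matrix.mul_assoc, hL, Matrix.mul_assoc, Matrix.nonsing_inv_mul _ hu, Matrix.mul_one]
  have h3 : L * (CYZ * CZ⁻¹ * L)ᵀ = CYZᵀ := by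
    rw [← Matrix.transpose_transpose L, ← Matrix.transpose_mul, Matrix.transpose_transpose, h2]
  rw [Matrix.fromBlocks_transpose, Matrix.fromBlocks_multiply, hA, h1, h2, h3, hL, condCov]
  simp

theorem fromBlocks_leftInverse {ι : Type*} [Fintype ι] [DecidableEq ι] {A : Matrix (Fin p) ι ℝ}
    {B : Matrix ι (Fin p) ℝ} {L : Matrix (Fin q) (Fin q) ℝ} (hBA : B * A = 1) (hL : L.det ≠ 0)
    (K : Matrix (Fin p) (Fin q) ℝ) :
    Matrix.fromBlocks B (-(B * K)) 0 L⁻¹ * Matrix.fromBlocks A (K * L) 0 L = 1 := by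
  rw [Matrix.fromBlocks_multiply, hBA, Matrix.nonsing_inv_mul _ (isUnit_iff_ne_zero.mpr hL)]
  simp [Matrix.mul_assoc]

end Factorization

theorem mainTheorem4 {p q : ℕ}
    (mY : EuclideanSpace ℝ (Fin p)) (mZ : EuclideanSpace ℝ (Fin q))
    (CY : Matrix (Fin p) (Fin p) ℝ) (CYZ : Matrix (Fin p) (Fin q) ℝ)
    (CZ : Matrix (Fin q) (Fin q) ℝ)
    (hC : (Matrix.fromBlocks CY CYZ CYZᵀ CZ).PosSemidef) (hCZ : CZ.PosDef)
    {Ω : ℕ → Type*} [∀ J, MeasurableSpace (Ω J)]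
    (P : ∀ J, Measure (Ω J)) [∀ J, IsProbabilityMeasure (P J)]
    (Y : ∀ J, Fin J → Ω J → EuclideanSpace ℝ (Fin p))
    (Z : ∀ J, Fin J → Ω J → EuclideanSpace ℝ (Fin q))
    (hindep : ∀ J, iIndepFun (fun i ω => joinVec (Y J i ω) (Z J i ω)) (P J))
    (hlaw : ∀ J i, HasLaw (fun ω => joinVec (Y J i ω) (Z J i ω))
      (multivariateGaussian (joinVec mY mZ) (Matrix.fromBlocks CY CYZ CYZᵀ CZ)) (P J))
    (z : EuclideanSpace ℝ (Fin q)) :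
    TendstoZeroInL2WithRate P
      (fun J ω => klDiv
        (multivariateGaussian (sampleMean (Z J · ω)) (sampleCov (Z J · ω)))
        (multivariateGaussian mZ CZ))
      (fun J => (J : ℝ)⁻¹) ∧
    TendstoZeroInL2WithRate P
      (fun J ω => klDiv
        (multivariateGaussian mZ CZ)
        (multivariateGaussian (sampleMean (Z J · ω)) (sampleCov (Z J · ω))))
      (fun J => (J : ℝ)⁻¹) ∧
    TendstoZeroInL2WithRate P
      (fun J ω => klDiv
        (multivariateGaussian (sampleCondMean (Y J · ω) (Z J · ω) z)
          (sampleCondCov (Y J · ω) (Z J · ω)))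
        (multivariateGaussian (condMean mY mZ CYZ CZ z) (condCov CY CYZ CZ)))
      (fun J => (J : ℝ)⁻¹) ∧
    TendstoZeroInL2WithRate P
      (fun J ω => klDiv
        (multivariateGaussian (condMean mY mZ CYZ CZ z) (condCov CY CYZ CZ))
        (multivariateGaussian (sampleCondMean (Y J · ω) (Z J · ω) z)
          (sampleCondCov (Y J · ω) (Z J · ω))))
      (fun J => (J : ℝ)⁻¹) := by
  obtain ⟨s, A, B, hBA, hA⟩ := (posSemidef_schur hC hCZ).exists_mul_transpose_eq_leftInverse
  obtain ⟨L, hL, hLL⟩ := exists_mul_transpose_eq_of_posDef hCZ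
  set K : Matrix (Fin p) (Fin q) ℝ := CYZ * CZ⁻¹ with hK
  set M := Matrix.fromBlocks A (K * L) 0 L with hM
  set N := Matrix.fromBlocks B (-(B * K)) 0 L⁻¹ with hN
  have hNM : N * M = 1 := fromBlocks_leftInverse hBA hL K
  rw [← fromBlocks_factor hCZ hA hLL] at hlaw
  set h : ∀ J, Fin J → Ω J → EuclideanSpace ℝ (s ⊕ Fin q) := fun J i ω =>
    -WithLp.toLp 2 (N *ᵥ (joinVec mY mZ).ofLp) +
      WithLp.toLp 2 (N *ᵥ (joinVec (Y J i ω) (Z J i ω)).ofLp) with hh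
  have hstd : ∀ J i, HasLaw (h J i) (stdGaussian (EuclideanSpace ℝ (s ⊕ Fin q))) (P J) :=
    fun J i => (hlaw J i).standardize hNM
  have hind : ∀ J, iIndepFun (h J) (P J) := fun J =>
    (hindep J).comp (fun _ x => -WithLp.toLp 2 (N *ᵥ (joinVec mY mZ).ofLp) +
      WithLp.toLp 2 (N *ᵥ x.ofLp)) fun _ => measurable_add_mulVec N _
  set R : Matrix (Fin q) (s ⊕ Fin q) ℝ := Matrix.fromCols 0 1 with hR
  have hRmul : ∀ v : s ⊕ Fin q → ℝ, R *ᵥ v = fun a => v (.inr a) := fun v => by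
    rw [hR, Matrix.fromCols_mulVec]
    simp [Function.comp_def]
  -- The `Z`-part of the standardized sample is written as an affine image, with zero offset, so
  -- that its law and independence follow from those of `h`.
  set ζ : ∀ J, Fin J → Ω J → EuclideanSpace ℝ (Fin q) := fun J i ω =>
    0 + WithLp.toLp 2 (R *ᵥ (h J i ω).ofLp) with hζ
  have hζ_apply : ∀ J i ω, (ζ J i ω).ofLp = fun a => h J i ω (.inr a) := fun J i ω => by
    simp only [hζ, zero_add, hRmul]
  have hζstd : ∀ J i, HasLaw (ζ J i) (stdGaussian (EuclideanSpace ℝ (Fin q))) (P J) := fun J i => by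
    have h1 := hstd J i
    rw [← multivariateGaussian_zero_one] at h1
    have h2 := h1.add_mulVec Matrix.PosSemidef.one R 0
    have h3 : R * (1 : Matrix (s ⊕ Fin q) (s ⊕ Fin q) ℝ) * Rᵀ = 1 := by
      rw [hR, Matrix.mul_one, Matrix.transpose_fromCols, Matrix.fromCols_mul_fromRows]
      simp
    rwa [h3, WithLp.ofLp_zero, Matrix.mulVec_zero, WithLp.toLp_zero, zero_add,
      multivariateGaussian_zero_one] at h2
  have hζind : ∀ J, iIndepFun (ζ J) (P J) := fun J =>
    (hind J).comp (fun _ x => 0 + WithLp.toLp 2 (R *ᵥ x.ofLp)) fun _ => measurable_add_mulVec R 0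
  set η' : ∀ J, Ω J → Fin J → s → ℝ := fun J ω i a => h J i ω (.inl a) with hη'
  set ζ' : ∀ J, Ω J → Fin J → Fin q → ℝ := fun J ω i => (ζ J i ω).ofLp with hζ'
  have hF : ∀ J ω, empCov (fun i => (h J i ω).ofLp) (fun i => (h J i ω).ofLp) =
      Matrix.fromBlocks (empCov (η' J ω) (η' J ω)) (empCov (η' J ω) (ζ' J ω))
        (empCov (η' J ω) (ζ' J ω))ᵀ (empCov (ζ' J ω) (ζ' J ω)) := fun J ω => by
    have : ζ' J ω = fun i a => h J i ω (.inr a) := funext fun i => hζ_apply J i ω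
    rw [this]
    exact empCov_sum_eq_fromBlocks _
  have hrep : ∀ J, ∀ᵐ ω ∂P J,
      (Y J · ω) = (fun i => mY + WithLp.toLp 2 (A *ᵥ η' J ω i + (K * L) *ᵥ ζ' J ω i)) ∧
      (Z J · ω) = fun i => mZ + WithLp.toLp 2 (L *ᵥ ζ' J ω i) := fun J => by
    have h1 := ae_all_iff.mpr fun i => (hlaw J i).ae_eq_add_mulVec_standardize hNM
    filter_upwards [h1] with ω h1
    have h2 : ∀ i, M *ᵥ (h J i ω).ofLp = Sum.elim (A *ᵥ η' J ω i + (K * L) *ᵥ ζ' J ω i)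
        (L *ᵥ ζ' J ω i) := fun i => by
      rw [hM, Matrix.fromBlocks_mulVec]
      simp only [hζ', hζ_apply, hη', Matrix.zero_mulVec, zero_add]
      rfl
    constructor
    · funext i
      ext a
      have := congrArg (fun v => v.ofLp (.inl a)) ((h1 i).trans (congrArg
        (fun v => joinVec mY mZ + WithLp.toLp 2 v) (h2 i)))
      simpa [joinVec] using this
    · funext i
      ext a
      have := congrArg (fun v => v.ofLp (.inr a)) ((h1 i).trans (congrArg
        (fun v => joinVec mY mZ + WithLp.toLp 2 v) (h2 i)))
      simpa [joinVec] using this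
  have hGrate := lpRate_empCov_sub_one hζstd hζind
  have hGdet := lpRate_inv_det_empCov hζstd hζind
  have hGpos := eventually_posDef_empCov hζstd hζind
  have hζmean := lpRate_vecMean hζstd hζind
  have hFrate := lpRate_empCov_sub_one hstd hind
  have hFdet := lpRate_inv_det_empCov hstd hind
  have hFpos := eventually_posDef_empCov hstd hind
  have hhmean := lpRate_vecMean hstd hind
  have hLinv : L⁻¹ * L = 1 := Matrix.nonsing_inv_mul _ (isUnit_iff_ne_zero.mpr hL)
  have part1 := tendstoZeroInL2WithRate_klDiv_image hLinv mZ hζmean hGrate hGdet hGpos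
    (m' := fun J ω => sampleMean (Z J · ω)) (C' := fun J ω => sampleCov (Z J · ω))
    (by
      filter_upwards [eventually_gt_atTop 0] with J hJ
      filter_upwards [hrep J] with ω hω
      rw [hω.2]
      exact sampleMean_affine hJ _ _ _)
    (by
      filter_upwards [eventually_gt_atTop 0] with J hJ
      filter_upwards [hrep J] with ω hω
      rw [hω.2]
      exact sampleCov_affine hJ _ _ _)
  rw [hLL] at part1
  refine ⟨part1.1, part1.2, ?_⟩
  simp only [hF] at hFrate hFdet hFpos
  have hErate : ∀ a c, LpRate P (fun J ω => empCov (η' J ω) (η' J ω) a c -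
      (1 : Matrix s s ℝ) a c) (fun J => (NNReal.sqrt J)⁻¹) := fun a c => by
    have := hFrate (.inl a) (.inl c)
    simpa [Matrix.one_apply] using this
  have hHrate : ∀ a c, LpRate P (fun J ω => empCov (η' J ω) (ζ' J ω) a c)
      (fun J => (NNReal.sqrt J)⁻¹) := fun a c => by
    have := hFrate (.inl a) (.inr c)
    simpa [Matrix.one_apply] using this
  have hGinv : ∀ a c, LpRate P (fun J ω => (empCov (ζ' J ω) (ζ' J ω))⁻¹ a c) 1 :=
    LpRate.matrix_inv (fun a c => LpRate.bdd_of_sub (hGrate a c)) hGdet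
  have hone : ∀ r : ℕ → ℝ≥0, (fun J => r J * (1 : ℕ → ℝ≥0) J) = r := fun r =>
    funext fun J => mul_one _
  have hHG : ∀ a c, LpRate P (fun J ω => (empCov (η' J ω) (ζ' J ω) *
      (empCov (ζ' J ω) (ζ' J ω))⁻¹) a c) (fun J => (NNReal.sqrt J)⁻¹) := fun a c => by
    have := LpRate.matrix_mul hHrate hGinv a c
    rwa [hone] at this
  have hHbdd : ∀ a c, LpRate P (fun J ω => (empCov (η' J ω) (ζ' J ω))ᵀ a c) 1 := fun a c =>
    LpRate.bdd_of_sub (c := 0) (by simpa using hHrate c a)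
  have hHGH : ∀ a c, LpRate P (fun J ω => (empCov (η' J ω) (ζ' J ω) *
      (empCov (ζ' J ω) (ζ' J ω))⁻¹ * (empCov (η' J ω) (ζ' J ω))ᵀ) a c)
      (fun J => (NNReal.sqrt J)⁻¹) := fun a c => by
    have := LpRate.matrix_mul hHG hHbdd a c
    rwa [hone] at this
  have part2 := tendstoZeroInL2WithRate_klDiv_image (P := P) hBA (condMean mY mZ CYZ CZ z)
    (m := fun J ω => vecMean (η' J ω) + (empCov (η' J ω) (ζ' J ω) *
      (empCov (ζ' J ω) (ζ' J ω))⁻¹) *ᵥ (L⁻¹ *ᵥ (z - mZ).ofLp - vecMean (ζ' J ω)))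
    (C := fun J ω => empCov (η' J ω) (η' J ω) - empCov (η' J ω) (ζ' J ω) *
      (empCov (ζ' J ω) (ζ' J ω))⁻¹ * (empCov (η' J ω) (ζ' J ω))ᵀ)
    (m' := fun J ω => sampleCondMean (Y J · ω) (Z J · ω) z)
    (C' := fun J ω => sampleCondCov (Y J · ω) (Z J · ω)) ?_ ?_ ?_ ?_ ?_ ?_
  · rwa [hA] at part2
  · intro a
    refine (hhmean (.inl a)).add ?_
    -- For fixed `z` this vector is merely bounded in every `Lᵏ`; smallness comes from `H G⁻¹`,
    -- whose factor `H` is centered at zero.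
    have hv : ∀ b, LpRate P (fun J ω => (L⁻¹ *ᵥ (z - mZ).ofLp - vecMean (ζ' J ω)) b) 1 := fun b => by
      refine (LpRate.const _).sub (LpRate.bdd_of_sub (c := 0) ?_)
      simpa using hζmean b
    have := LpRate.mulVec hHG hv a
    rwa [hone] at this
  · intro a c
    refine ((hErate a c).sub (hHGH a c)).congr_ae (Eventually.of_forall fun J => ae_of_all _ fun ω => ?_)
    simp only [Matrix.sub_apply]
    ring
  -- The inverse determinant of the Schur complement is `det G * (det F)⁻¹`, where `F` is the full
  -- empirical covariance and `G` its `ζ` block.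
  · refine ((LpRate.det fun a c => LpRate.bdd_of_sub (hGrate a c)).bdd_mul hFdet).congr_ae ?_
    filter_upwards [hGpos] with J h1
    filter_upwards [h1] with ω h1
    have h2 : (empCov (ζ' J ω) (ζ' J ω)).det ≠ 0 := h1.det_pos.ne'
    rw [det_fromBlocks_eq_mul_det_schur h2, mul_inv]
    exact mul_inv_cancel_left₀ h2 _
  · filter_upwards [hGpos, hFpos] with J h1 h2
    filter_upwards [h1, h2] with ω h1 h2
    exact posDef_schur h2 h1
  · filter_upwards [hGpos, eventually_gt_atTop 0] with J h1 hJ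
    filter_upwards [h1, hrep J] with ω h1 hω
    rw [hω.1, hω.2]
    exact sampleCondMean_of_factor mY mZ _ _ hJ hL h1.det_pos.ne' z
  · filter_upwards [hGpos, eventually_gt_atTop 0] with J h1 hJ
    filter_upwards [h1, hrep J] with ω h1 hω
    rw [hω.1, hω.2]
    exact sampleCondCov_of_factor mY mZ _ _ hJ hL h1.det_pos.ne'
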